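/- Let $B_0=(-1,1]$ and $B_m=(-2^m,2^m]\setminus(-2^{m-1},2^{m-1}]$ for integers $m\ge 1$. Let $\alpha>1$, let $H=N(\mu_H,\sigma_H^2)$ with $\sigma_H^2>0$, let $p\in[1,\infty)$, and let $K,A$ be constants. Then there is a constant $K'$, depending only on $\alpha,\mu_H,\sigma_H,p,K,A$, such that the following holds. Let $X_1,X_2,\dots$ be i.i.d. real random variables with law $P_0$ possessing a Lebesgue density $p_0$, and suppose that $P_0(B_m)\le K2^{-pm}$ for every $m\ge 0$. Let $\epsilon_n\to 0$ be a sequence with $\sqrt{\log n/n}\le\epsilon_n\le A\,n^{-p/(2+2p)}$ for every $n\ge 1$, and let $\sigma_n>0$ with $\sigma_n\to 0$. Let $\Pi_n$ be the Dirichlet process mixture prior, i.e. the law of the random density $$p_G(x)=\int\phi_{\sigma_n}(x-z)\,dG(z),\qquad G\sim\mathrm{DP}(\alpha H),$$ where $\phi_\sigma$ is the density of $N(0,\sigma^2)$ and $\mathrm{DP}(\alpha H)$ is the Dirichlet process with base measure $\alpha H$ (the law of a random probability measure $G$ such that $(G(A_1),\dots,G(A_k))$ has the Dirichlet distribution with parameters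 $(\alpha H(A_1),\dots,\alpha H(A_k))$ for every finite Borel partition $A_1,\dots,A_k$ of $\mathbb R$). Suppose that $\Pi_n(\mathcal K_n)\ge e^{-n\epsilon_n^2}$ for all large enough $n$, where $$\mathcal K_n=\Big\{q:\ \int\log\frac{p_0}{q}\,dP_0\le\epsilon_n^2,\ \int\Big(\log\frac{p_0}{q}\Big)^2dP_0\le\epsilon_n^2\Big\}.$$ For a set $\mathcal A$ of densities let $$\Pi_n(\mathcal A\mid X_1,\dots,X_n)=\frac{\int_{\mathcal A}\prod_{i=1}^n q(X_i)/p_0(X_i)\,d\Pi_n(q)}{\int\prod_{i=1}^n q(X_i)/p_0(X_i)\,d\Pi_n(q)}$$ denote the posterior probability, and write $Q$ for the probability measure with density $q$. Then, as $n\to\infty$, $$\Pi_n\big(q:\ Q(B_m)\le K'2^{-pm}\ \text{ for all } m\ge 0\ \big|\ X_1,\dots,X_n\big)\longrightarrow 1\quad\text{in probability.}$$ -/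

import Mathlib

open MeasureTheory ProbabilityTheory Filter Topology
open scoped ENNReal NNReal

noncomputable section

/-- The Gamma law with shape `a` and rate `1`, where shape `0` is the point mass at `0`
(negative shapes are irrelevant and also give the point mass). -/
def gammaLaw (a : ℝ) : Measure ℝ :=
  if 0 < a then gammaMeasure a 1 else Measure.dirac 0

instance (a : ℝ) : IsProbabilityMeasure (gammaLaw a) := by
  unfold gammaLaw
  split_ifs with h
  · exact isProbabilityMeasure_gammaMeasure h one_pos
  · infer_instance

/-- The Dirichlet distribution with nonnegative, not all zero, parameters `a 0, …, a (k - 1)`: the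
law of `(Z_i / ∑ j, Z_j)_i` where the `Z_i ∼ Gamma(a i, 1)` are independent.  Coordinates with
parameter `0` vanish almost surely. -/
def dirichletLaw {k : ℕ} (a : Fin k → ℝ) : Measure (Fin k → ℝ) :=
  (Measure.pi fun i => gammaLaw (a i)).map fun z i => z i / ∑ j, z j

/-- `D` is the law of the Dirichlet process `DP(α H)`: a random probability measure `G ∼ D`
satisfies `(G(A_1), …, G(A_k)) ∼ Dirichlet(α H(A_1), …, α H(A_k))` for each finite measurable
partition `A_1, …, A_k` of the space. -/
def IsDirichletProcess {S : Type*} [MeasurableSpace S] (α : ℝ) (H : Measure S)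
    (D : Measure (ProbabilityMeasure S)) : Prop :=
  ∀ (k : ℕ) (A : Fin k → Set S), (∀ i, MeasurableSet (A i)) →
    Pairwise (fun i j => Disjoint (A i) (A j)) → (⋃ i, A i) = Set.univ →
    D.map (fun (G : ProbabilityMeasure S) (i : Fin k) => (G : Measure S).real (A i)) =
      dirichletLaw fun i => α * H.real (A i)

/-- The Borel measure on the line with Lebesgue density `p`. -/
def densityMeasure (p : ℝ → ℝ) : Measure ℝ :=
  volume.withDensity fun x => ENNReal.ofReal (p x)

/-- The location mixture `x ↦ ∫ φ_σ(x - z) dG(z)`, where `φ_σ` is the density of `N(0, σ²)`. -/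
def normalMixture (σ : ℝ≥0) (G : ProbabilityMeasure ℝ) (x : ℝ) : ℝ :=
  ∫ z, gaussianPDFReal 0 (σ ^ 2) (x - z) ∂(G : Measure ℝ)

/-- The dyadic shells `B_0 = (-1, 1]` and `B_m = (-2^m, 2^m] \ (-2^(m-1), 2^(m-1)]`, `m ≥ 1`. -/
def dyadicShell : ℕ → Set ℝ
  | 0 => Set.Ioc (-1) 1
  | m + 1 => Set.Ioc (-2 ^ (m + 1)) (2 ^ (m + 1)) \ Set.Ioc (-2 ^ m) (2 ^ m)

/-- The densities `p` with `∫ log (p₀ / p) dP₀ ≤ ε²` and `∫ (log (p₀ / p))² dP₀ ≤ ε²`, where the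
second integral being finite is made explicit. -/
def klNeighborhood (p₀ : ℝ → ℝ) (ε : ℝ) : Set (ℝ → ℝ) :=
  {p | MemLp (fun x => Real.log (p₀ x / p x)) 2 (densityMeasure p₀) ∧
    ∫ x, Real.log (p₀ x / p x) ∂densityMeasure p₀ ≤ ε ^ 2 ∧
    ∫ x, Real.log (p₀ x / p x) ^ 2 ∂densityMeasure p₀ ≤ ε ^ 2}

/-- The prior on densities is the law of the random density `f θ`, `θ ∼ Q`.
This is the prior probability of a set `A` of densities. -/
def priorProb {Θ : Type*} [MeasurableSpace Θ] (Q : Measure Θ) (f : Θ → ℝ → ℝ)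
    (A : Set (ℝ → ℝ)) : ℝ :=
  Q.real {θ | f θ ∈ A}

/-- The integrated likelihood ratio `∫_A ∏ i, p (x i) / p₀ (x i) dΠ(p)`, where `Π` is the law of
the random density `f θ`, `θ ∼ Q`. -/
def integratedLikelihood {Θ : Type*} [MeasurableSpace Θ] (Q : Measure Θ) (f : Θ → ℝ → ℝ)
    (p₀ : ℝ → ℝ) {n : ℕ} (x : Fin n → ℝ) (A : Set (ℝ → ℝ)) : ℝ≥0∞ :=
  ∫⁻ θ in {θ | f θ ∈ A}, ∏ i, ENNReal.ofReal (f θ (x i) / p₀ (x i)) ∂Q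

/-- The posterior probability of a set `A` of densities given the observations `x`, by the Bayes
formula. -/
def posteriorProb {Θ : Type*} [MeasurableSpace Θ] (Q : Measure Θ) (f : Θ → ℝ → ℝ)
    (p₀ : ℝ → ℝ) {n : ℕ} (x : Fin n → ℝ) (A : Set (ℝ → ℝ)) : ℝ :=
  (integratedLikelihood Q f p₀ x A / integratedLikelihood Q f p₀ x Set.univ).toReal

/-- The densities `p` whose measure `P` satisfies `P(B_m) ≤ K 2^(-p m)` for all `m ≥ 0`
(the exponent is called `s` here). -/
def shellBounded (s K : ℝ) : Set (ℝ → ℝ) :=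
  {p | ∀ m : ℕ, densityMeasure p (dyadicShell m) ≤ ENNReal.ofReal (K * 2 ^ (-(s * m)))}

end

/-! Write `u = n ε²`. Chebyshev's inequality on the Kullback–Leibler neighbourhood, whose prior mass
is at least `e^(-u)`, shows that the evidence (the denominator of the posterior) is at least
`e^(-3u)/2` with high probability (`measure_integratedLikelihood_univ_lt_le`). It remains to show
that the bad sets `U m = {Q(B_m) > K' 2^(-pm)}` contribute in total `O(e^(-4u))` to the numerator.
There are two regimes.

Near shells, `2^(-pm) ≥ ε²`: the number of observations in `B_m` is a test. Under `p₀` it exceeds a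
suitable multiple of `n 2^(-pm) ≥ u` with exponentially small probability, and under a density in `U
m` it stays below with exponentially small probability. At most `n ≤ e^u` shells are near, by the
lower bound on `ε`.

Far shells, `2^(-pm) < ε²`: the prior mass of `U m` is itself tiny. The prior mean of `Q(B_m)` is at
most a constant times the mass of `B_m` under the Gaussian `N(μH, vH + σ²)`, which decays faster
than any exponential in `2^m`. The upper bound on `ε` gives `u ≤ a 2^m` on far shells
(`mul_sq_le_of_two_rpow_lt`), so Markov's inequality yields `C e^(-4u) 2^(-m)`, summable in `m`.

`measure_le_abs_posteriorProb_sub_one_le` combines the evidence bound, the tests and the prior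
masses. -/

/-! ### Moments of Gamma and Dirichlet laws. -/

lemma ae_nonneg_gammaLaw (a : ℝ) : ∀ᵐ x ∂gammaLaw a, 0 ≤ x := by
  unfold gammaLaw
  split_ifs with ha
  · rw [gammaMeasure, ae_iff]
    have : {x : ℝ | ¬ 0 ≤ x} = Set.Iio 0 := by ext; simp
    rw [this, withDensity_apply _ measurableSet_Iio]
    exact lintegral_gammaPDF_of_nonpos le_rfl
  · rw [ae_dirac_iff measurableSet_Ici]

lemma measurable_gammaPDF (a r : ℝ) : Measurable (gammaPDF a r) :=
  (measurable_gammaPDFReal a r).ennreal_ofReal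

lemma lintegral_id_gammaLaw_le (a : ℝ) :
    ∫⁻ x, ENNReal.ofReal x ∂gammaLaw a ≤ ENNReal.ofReal a := by
  unfold gammaLaw
  split_ifs with h
  · rw [gammaMeasure, lintegral_withDensity_eq_lintegral_mul _ (measurable_gammaPDF a 1)
      ENNReal.measurable_ofReal]
    calc ∫⁻ x, (gammaPDF a 1 * ENNReal.ofReal) x
        ≤ ∫⁻ x, ENNReal.ofReal a * gammaPDF (a + 1) 1 x := by
          refine lintegral_mono fun x => ?_
          rcases le_or_gt x 0 with hx | hx
          · simp [ENNReal.ofReal_of_nonpos hx]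
          · simp only [Pi.mul_apply]
            rw [gammaPDF_of_nonneg hx.le, gammaPDF_of_nonneg hx.le,
              ← ENNReal.ofReal_mul (by positivity), ← ENNReal.ofReal_mul h.le]
            refine ENNReal.ofReal_le_ofReal (le_of_eq ?_)
            have hG := Real.Gamma_pos_of_pos h
            rw [Real.Gamma_add_one h.ne', Real.rpow_sub_one hx.ne', add_sub_cancel_right]
            simp only [Real.one_rpow]
            field_simp
      _ = ENNReal.ofReal a := by
          rw [lintegral_const_mul _ (measurable_gammaPDF _ _),
            lintegral_gammaPDF_eq_one (by linarith) one_pos, mul_one]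
  · simp

lemma lintegral_inv_gammaLaw_le {a : ℝ} (ha : 1 < a) :
    ∫⁻ x, ENNReal.ofReal x⁻¹ ∂gammaLaw a ≤ ENNReal.ofReal (a - 1)⁻¹ := by
  have h : 0 < a := by linarith
  have h1 : 0 < a - 1 := by linarith
  rw [gammaLaw, if_pos h, gammaMeasure, lintegral_withDensity_eq_lintegral_mul _
    (measurable_gammaPDF a 1) (by fun_prop)]
  calc ∫⁻ x, (gammaPDF a 1 * fun x => ENNReal.ofReal x⁻¹) x
      ≤ ∫⁻ x, ENNReal.ofReal (a - 1)⁻¹ * gammaPDF (a - 1) 1 x := by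
        refine lintegral_mono fun x => ?_
        rcases le_or_gt x 0 with hx | hx
        · simp [ENNReal.ofReal_of_nonpos (inv_nonpos.2 hx)]
        · simp only [Pi.mul_apply]
          rw [gammaPDF_of_nonneg hx.le, gammaPDF_of_nonneg hx.le,
            ← ENNReal.ofReal_mul (by positivity), ← ENNReal.ofReal_mul (by positivity)]
          refine ENNReal.ofReal_le_ofReal (le_of_eq ?_)
          have hG := Real.Gamma_pos_of_pos h1
          have hG' : Real.Gamma a = (a - 1) * Real.Gamma (a - 1) := by
            rw [← Real.Gamma_add_one h1.ne', sub_add_cancel]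
          rw [hG', Real.rpow_sub_one hx.ne' (a - 1)]
          simp only [Real.one_rpow]
          field_simp
    _ = ENNReal.ofReal (a - 1)⁻¹ := by
        rw [lintegral_const_mul _ (measurable_gammaPDF _ _),
          lintegral_gammaPDF_eq_one h1 one_pos, mul_one]

/-- The exact mean is `a / (a + b)`; the cruder bound `E[Z₀ / (Z₀ + Z₁)] ≤ E[Z₀] E[1 / Z₁]` avoids
the Beta law and costs only a constant. Finiteness of `E[1 / Z₁]` is what requires `b > 1`. -/
lemma lintegral_dirichletLaw_two_le {a b : ℝ} (ha : 0 ≤ a) (hb : 1 < b) :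
    ∫⁻ v, ENNReal.ofReal (v 0) ∂dirichletLaw ![a, b] ≤ ENNReal.ofReal (a / (b - 1)) := by
  have hb1 : 0 < b - 1 := by linarith
  have hm : Measurable fun z : Fin 2 → ℝ => fun i => z i / ∑ j, z j := by fun_prop
  have hmp := measurePreserving_piFinTwo (fun i : Fin 2 => gammaLaw (![a, b] i))
  rw [dirichletLaw, lintegral_map (by fun_prop) hm]
  have h1 : ∫⁻ z, ENNReal.ofReal (z 0 / ∑ j, z j)
        ∂(Measure.pi fun i : Fin 2 => gammaLaw (![a, b] i)) =
      ∫⁻ w : ℝ × ℝ, ENNReal.ofReal (w.1 / (w.1 + w.2)) ∂((gammaLaw a).prod (gammaLaw b)) := by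
    have := hmp.lintegral_comp (f := fun w : ℝ × ℝ => ENNReal.ofReal (w.1 / (w.1 + w.2)))
      (by fun_prop)
    simpa [MeasurableEquiv.piFinTwo, Fin.sum_univ_two] using this
  rw [h1]
  rw [lintegral_prod _ (by fun_prop)]
  calc ∫⁻ x, ∫⁻ y, ENNReal.ofReal (x / (x + y)) ∂gammaLaw b ∂gammaLaw a
      ≤ ∫⁻ x, ∫⁻ y, ENNReal.ofReal x * ENNReal.ofReal y⁻¹ ∂gammaLaw b ∂gammaLaw a := by
        refine lintegral_mono_ae ?_
        filter_upwards [ae_nonneg_gammaLaw a] with x hx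
        refine lintegral_mono_ae ?_
        -- Since `0⁻¹ = 0`, the pointwise bound fails at `y = 0`, which must be discarded as a null
        -- set.
        have hne : ∀ᵐ y ∂gammaLaw b, y ≠ 0 := by
          rw [gammaLaw, if_pos (by linarith), gammaMeasure]
          exact (withDensity_absolutelyContinuous _ _).ae_le
            (compl_mem_ae_iff.2 (measure_singleton (0 : ℝ)))
        filter_upwards [ae_nonneg_gammaLaw b, hne] with y hy hy0
        have hy' : 0 < y := lt_of_le_of_ne hy hy0.symm
        rw [← ENNReal.ofReal_mul hx, ← div_eq_mul_inv]
        exact ENNReal.ofReal_le_ofReal (div_le_div_of_nonneg_left hx hy' (by linarith))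
    _ = (∫⁻ x, ENNReal.ofReal x ∂gammaLaw a) * ∫⁻ y, ENNReal.ofReal y⁻¹ ∂gammaLaw b := by
        rw [← lintegral_mul_const _ (by fun_prop)]
        refine lintegral_congr fun x => ?_
        rw [lintegral_const_mul _ (by fun_prop)]
    _ ≤ ENNReal.ofReal a * ENNReal.ofReal (b - 1)⁻¹ :=
        mul_le_mul' (lintegral_id_gammaLaw_le a) (lintegral_inv_gammaLaw_le hb)
    _ = ENNReal.ofReal (a / (b - 1)) := by rw [← ENNReal.ofReal_mul ha, div_eq_mul_inv]

instance isProbabilityMeasure_dirichletLaw {k : ℕ} (a : Fin k → ℝ) :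
    IsProbabilityMeasure (dirichletLaw a) :=
  Measure.isProbabilityMeasure_map (by fun_prop)

/-! ### Prior means under the Dirichlet process. -/

lemma ProbabilityMeasure.measurable_apply {S : Type*} [MeasurableSpace S] {s : Set S}
    (hs : MeasurableSet s) : Measurable fun G : ProbabilityMeasure S => (G : Measure S) s :=
  (Measure.measurable_coe hs).comp measurable_subtype_coe

/-- The one-cell partition already determines the total mass. -/
lemma IsDirichletProcess.isProbabilityMeasure {S : Type*} [MeasurableSpace S] {α : ℝ}
    {H : Measure S} {D : Measure (ProbabilityMeasure S)} (h : IsDirichletProcess α H D) :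
    IsProbabilityMeasure D := by
  have h1 := h 1 (fun _ => Set.univ) (fun _ => MeasurableSet.univ)
    (fun i j hij => (hij (Subsingleton.elim i j)).elim) (Set.iUnion_const _)
  have hm : Measurable (fun (G : ProbabilityMeasure S) (_ : Fin 1) =>
      (G : Measure S).real Set.univ) :=
    measurable_pi_lambda _ fun _ =>
      (ProbabilityMeasure.measurable_apply MeasurableSet.univ).ennreal_toReal
  constructor
  have h2 := congrArg (fun μ => μ Set.univ) h1
  rw [Measure.map_apply hm MeasurableSet.univ, Set.preimage_univ] at h2
  rw [h2, measure_univ]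

lemma IsDirichletProcess.lintegral_apply_le {S : Type*} [MeasurableSpace S] {α : ℝ} (hα : 1 < α)
    {H : Measure S} [IsProbabilityMeasure H] {D : Measure (ProbabilityMeasure S)}
    (h : IsDirichletProcess α H D) {s : Set S} (hs : MeasurableSet s) :
    ∫⁻ G, (G : Measure S) s ∂D ≤ ENNReal.ofReal (2 * α / (α - 1)) * H s := by
  have hD := h.isProbabilityMeasure
  have hα1 : 0 < α - 1 := by linarith
  rw [← ENNReal.ofReal_toReal (measure_ne_top H s), ← ENNReal.ofReal_mul (by positivity)]
  change _ ≤ ENNReal.ofReal (_ * H.real s)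
  have h0 : 0 ≤ H.real s := measureReal_nonneg
  -- Below this threshold the second Dirichlet parameter exceeds `1` by at least `(α - 1) / 2`;
  -- above it the claimed bound is at least `1`, hence trivial. This is where `α > 1` enters.
  by_cases hc : α * H.real s ≤ (α - 1) / 2
  · have h1 := h 2 ![s, sᶜ] (by simp [Fin.forall_fin_two, hs])
      (by
        intro i j hij
        fin_cases i <;> fin_cases j <;> simp_all [disjoint_compl_right, disjoint_compl_left])
      (by
        ext x
        simp [Fin.exists_fin_two, em])
    have hm : Measurable (fun (G : ProbabilityMeasure S) (i : Fin 2) =>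
        (G : Measure S).real ((![s, sᶜ] : Fin 2 → Set S) i)) := by
      refine measurable_pi_lambda _ fun i => ?_
      fin_cases i
      · exact (ProbabilityMeasure.measurable_apply hs).ennreal_toReal
      · exact (ProbabilityMeasure.measurable_apply hs.compl).ennreal_toReal
    have h2 : (fun i : Fin 2 => α * H.real ((![s, sᶜ] : Fin 2 → Set S) i)) =
        ![α * H.real s, α * (1 - H.real s)] := by
      ext i
      fin_cases i
      · simp
      · simp [probReal_compl_eq_one_sub hs]
    rw [h2] at h1
    calc ∫⁻ G, (G : Measure S) s ∂D
        = ∫⁻ v, ENNReal.ofReal (v 0) ∂dirichletLaw ![α * H.real s, α * (1 - H.real s)] := by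
          rw [← h1, lintegral_map (by fun_prop) hm]
          refine lintegral_congr fun G => ?_
          simp [measureReal_def]
      _ ≤ ENNReal.ofReal (α * H.real s / (α * (1 - H.real s) - 1)) :=
          lintegral_dirichletLaw_two_le (by positivity) (by nlinarith)
      _ ≤ _ := by
          refine ENNReal.ofReal_le_ofReal ?_
          have hb : (α - 1) / 2 ≤ α * (1 - H.real s) - 1 := by linarith
          calc α * H.real s / (α * (1 - H.real s) - 1) ≤ α * H.real s / ((α - 1) / 2) :=
                div_le_div_of_nonneg_left (by positivity) (by positivity) hb
            _ = _ := by field_simp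
  · calc ∫⁻ G, (G : Measure S) s ∂D ≤ ∫⁻ _, 1 ∂D := lintegral_mono fun G => prob_le_one
      _ = ENNReal.ofReal 1 := by simp
      _ ≤ _ := by
          refine ENNReal.ofReal_le_ofReal ?_
          rw [div_mul_eq_mul_div, le_div_iff₀ hα1]
          linarith

/-- Integrating a nonnegative function against a Dirichlet process. -/
lemma IsDirichletProcess.lintegral_lintegral_le {S : Type*} [MeasurableSpace S] {α : ℝ}
    (hα : 1 < α) {H : Measure S} [IsProbabilityMeasure H] {D : Measure (ProbabilityMeasure S)}
    (h : IsDirichletProcess α H D) {g : S → ℝ≥0∞} (hg : Measurable g) :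
    ∫⁻ G, ∫⁻ z, g z ∂(G : Measure S) ∂D ≤ ENNReal.ofReal (2 * α / (α - 1)) * ∫⁻ z, g z ∂H := by
  have hm : Measurable fun G : ProbabilityMeasure S => (G : Measure S) := measurable_subtype_coe
  rw [← Measure.lintegral_bind hm.aemeasurable hg.aemeasurable, ← smul_eq_mul,
    ← lintegral_smul_measure]
  -- The bound on sets says that the mean measure `D.bind` is dominated by a multiple of `H`, which
  -- then applies to every integrand.
  refine lintegral_mono' (Measure.le_intro fun s hs _ => ?_) le_rfl
  rw [Measure.bind_apply hs hm.aemeasurable]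
  simpa using h.lintegral_apply_le hα hs

/-! ### Normal mixtures and Gaussian tails. -/

/-- The tautological kernel. -/
noncomputable def ProbabilityMeasure.coeKernel (S : Type*) [MeasurableSpace S] :
    Kernel (ProbabilityMeasure S) S where
  toFun G := G
  measurable' := measurable_subtype_coe

instance (S : Type*) [MeasurableSpace S] :
    IsMarkovKernel (ProbabilityMeasure.coeKernel S) :=
  ⟨fun G => G.2⟩

lemma measurable_normalMixture (σ : ℝ≥0) :
    Measurable (Function.uncurry (normalMixture σ)) := by
  have h : StronglyMeasurable (Function.uncurry fun (q : ProbabilityMeasure ℝ × ℝ) (z : ℝ) =>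
      gaussianPDFReal 0 (σ ^ 2) (q.2 - z)) := by
    apply Measurable.stronglyMeasurable
    exact (measurable_gaussianPDFReal 0 (σ ^ 2)).comp (by fun_prop)
  exact (h.integral_kernel_prod_right
    (κ := (ProbabilityMeasure.coeKernel ℝ).comap Prod.fst measurable_fst)).measurable

lemma gaussianPDFReal_le (μ : ℝ) (v : ℝ≥0) (x : ℝ) :
    gaussianPDFReal μ v x ≤ (√(2 * Real.pi * v))⁻¹ := by
  rw [gaussianPDFReal]
  refine mul_le_of_le_one_right (by positivity) (Real.exp_le_one_iff.2 ?_)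
  rw [neg_div]
  exact neg_nonpos.2 (by positivity)

lemma integrable_gaussianPDFReal_sub (v : ℝ≥0) (G : ProbabilityMeasure ℝ) (x : ℝ) :
    Integrable (fun z => gaussianPDFReal 0 v (x - z)) (G : Measure ℝ) := by
  refine Integrable.of_bound (C := (√(2 * Real.pi * v))⁻¹)
    ((measurable_gaussianPDFReal 0 v).comp (by fun_prop)).aestronglyMeasurable
    (ae_of_all _ fun z => ?_)
  rw [Real.norm_of_nonneg (gaussianPDFReal_nonneg _ _ _)]
  exact gaussianPDFReal_le _ _ _

lemma normalMixture_pos {σ : ℝ≥0} (hσ : 0 < σ) (G : ProbabilityMeasure ℝ) (x : ℝ) :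
    0 < normalMixture σ G x := by
  have h : ∀ z, 0 < gaussianPDFReal 0 (σ ^ 2) (x - z) := fun z =>
    gaussianPDFReal_pos _ _ _ (by positivity)
  rw [normalMixture, integral_pos_iff_support_of_nonneg (fun z => (h z).le)
    (integrable_gaussianPDFReal_sub _ G x)]
  have : Function.support (fun z => gaussianPDFReal 0 (σ ^ 2) (x - z)) = Set.univ := by
    ext z
    simp [(h z).ne']
  simp [this]

lemma densityMeasure_normalMixture {σ : ℝ≥0} (hσ : 0 < σ) (G : ProbabilityMeasure ℝ) {s : Set ℝ}
    (hs : MeasurableSet s) :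
    densityMeasure (normalMixture σ G) s = ∫⁻ z, gaussianReal z (σ ^ 2) s ∂(G : Measure ℝ) := by
  have hσ2 : σ ^ 2 ≠ 0 := by positivity
  rw [densityMeasure, withDensity_apply _ hs]
  calc ∫⁻ x in s, ENNReal.ofReal (normalMixture σ G x)
      = ∫⁻ x in s, ∫⁻ z, gaussianPDF z (σ ^ 2) x ∂(G : Measure ℝ) := by
        refine lintegral_congr fun x => ?_
        rw [normalMixture, ofReal_integral_eq_lintegral_ofReal
          (integrable_gaussianPDFReal_sub _ G x) (ae_of_all _ fun z => gaussianPDFReal_nonneg _ _ _)]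
        refine lintegral_congr fun z => ?_
        rw [gaussianPDF, gaussianPDFReal_sub, zero_add]
    _ = ∫⁻ z, (∫⁻ x in s, gaussianPDF z (σ ^ 2) x) ∂(G : Measure ℝ) := by
        refine lintegral_lintegral_swap (μ := volume.restrict s) (ν := (G : Measure ℝ))
          (f := fun x z => gaussianPDF z (σ ^ 2) x) (Measurable.aemeasurable ?_)
        unfold Function.uncurry gaussianPDF gaussianPDFReal
        fun_prop
    _ = _ := by
        refine lintegral_congr fun z => ?_
        rw [gaussianReal_apply _ hσ2]

lemma isProbabilityMeasure_densityMeasure_normalMixture {σ : ℝ≥0} (hσ : 0 < σ)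
    (G : ProbabilityMeasure ℝ) : IsProbabilityMeasure (densityMeasure (normalMixture σ G)) :=
  ⟨by simp [densityMeasure_normalMixture hσ G MeasurableSet.univ]⟩

/-- Identifies the mixture of `N(z, w)` over Gaussian `z`, which controls the prior mean of the
random density. -/
lemma gaussianReal_conv_apply (μ : ℝ) (v w : ℝ≥0) {s : Set ℝ} (hs : MeasurableSet s) :
    ∫⁻ z, gaussianReal z w s ∂gaussianReal μ v = gaussianReal μ (v + w) s := by
  have h := gaussianReal_conv_gaussianReal (m₁ := μ) (m₂ := 0) (v₁ := v) (v₂ := w)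
  rw [add_zero] at h
  rw [← h, Measure.conv, Measure.map_apply (by fun_prop) hs,
    Measure.prod_apply (measurable_add hs)]
  refine lintegral_congr fun z => ?_
  have h2 := gaussianReal_map_const_add (μ := 0) (v := w) z
  rw [zero_add] at h2
  rw [← h2, Measure.map_apply (by fun_prop) hs]
  rfl

lemma measurable_gaussianReal_apply (w : ℝ≥0) {s : Set ℝ} (hs : MeasurableSet s) :
    Measurable fun z => gaussianReal z w s := by
  have h : (fun z => gaussianReal z w s) =
      fun z => gaussianReal 0 w (Prod.mk z ⁻¹' ((fun q : ℝ × ℝ => q.1 + q.2) ⁻¹' s)) := by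
    ext z
    have h2 := gaussianReal_map_const_add (μ := 0) (v := w) z
    rw [zero_add] at h2
    rw [← h2, Measure.map_apply (by fun_prop) hs]
    rfl
  rw [h]
  exact measurable_measure_prodMk_left (measurable_add hs)

/-- The prior mean of the mass of a set under a Dirichlet process mixture of normals. -/
lemma IsDirichletProcess.lintegral_densityMeasure_normalMixture_le {α : ℝ} (hα : 1 < α) {μH : ℝ}
    {vH : ℝ≥0} {D : Measure (ProbabilityMeasure ℝ)}
    (h : IsDirichletProcess α (gaussianReal μH vH) D) {σ : ℝ≥0} (hσ : 0 < σ) {s : Set ℝ}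
    (hs : MeasurableSet s) :
    ∫⁻ G, densityMeasure (normalMixture σ G) s ∂D ≤
      ENNReal.ofReal (2 * α / (α - 1)) * gaussianReal μH (vH + σ ^ 2) s := by
  simp_rw [densityMeasure_normalMixture hσ _ hs]
  rw [← gaussianReal_conv_apply _ _ _ hs]
  exact h.lintegral_lintegral_le hα (measurable_gaussianReal_apply _ hs)

/-- Chernoff's bound on both tails. The rate `t` stays free so that it can later be chosen to beat
any given multiple of `2^m`. -/
lemma gaussianReal_le_abs_le (μ : ℝ) (v : ℝ≥0) {t : ℝ} (ht : 0 ≤ t) (r : ℝ) :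
    gaussianReal μ v {x | r ≤ |x|} ≤
      ENNReal.ofReal (2 * Real.exp (|μ| * t + v * t ^ 2 / 2 - t * r)) := by
  have h1 : (gaussianReal μ v).real {x | r ≤ x} ≤
      Real.exp (|μ| * t + v * t ^ 2 / 2 - t * r) := by
    refine (measure_ge_le_exp_mul_mgf (X := id) r ht (integrable_exp_mul_gaussianReal t)).trans ?_
    rw [mgf_id_gaussianReal, ← Real.exp_add]
    exact Real.exp_le_exp.2 (by nlinarith [le_abs_self μ])
  have h2 : (gaussianReal μ v).real {x | x ≤ -r} ≤
      Real.exp (|μ| * t + v * t ^ 2 / 2 - t * r) := by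
    refine (measure_le_le_exp_mul_mgf (X := id) (t := -t) (-r) (by linarith)
      (integrable_exp_mul_gaussianReal (-t))).trans ?_
    rw [mgf_id_gaussianReal, ← Real.exp_add]
    exact Real.exp_le_exp.2 (by nlinarith [neg_abs_le μ])
  have hsub : {x : ℝ | r ≤ |x|} ⊆ {x | r ≤ x} ∪ {x | x ≤ -r} := by
    intro x hx
    rcases le_abs.1 (show r ≤ |x| from hx) with h | h
    · exact Or.inl h
    · exact Or.inr (show x ≤ -r by linarith)
  rw [← ofReal_measureReal]
  refine ENNReal.ofReal_le_ofReal ?_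
  have := (measureReal_mono (μ := gaussianReal μ v) hsub).trans (measureReal_union_le _ _)
  linarith

/-! ### Counts and likelihood ratios of an i.i.d. sample. -/

/-- The number of the first `n` observations that fall in `B`. -/
noncomputable def sampleCount {Ω : Type*} (X : ℕ → Ω → ℝ) (B : Set ℝ) (n : ℕ) (ω : Ω) : ℝ :=
  ∑ i : Fin n, B.indicator 1 (X i ω)

lemma ofReal_exp_mul_sampleCount {Ω : Type*} (X : ℕ → Ω → ℝ) (B : Set ℝ) (n : ℕ) (s : ℝ) (ω : Ω) :
    ENNReal.ofReal (Real.exp (s * sampleCount X B n ω)) =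
      ∏ i : Fin n, ENNReal.ofReal (Real.exp (s * B.indicator 1 (X i ω))) := by
  rw [sampleCount, Finset.mul_sum, Real.exp_sum,
    ENNReal.ofReal_prod_of_nonneg fun i _ => (Real.exp_pos _).le]

section IIDSample

variable {Ω : Type*} [MeasurableSpace Ω] {P : Measure Ω} {X : ℕ → Ω → ℝ} {p₀ : ℝ → ℝ}

/-- Expectations of products over an i.i.d. sample. -/
lemma lintegral_prod_iid [IsProbabilityMeasure P] (hX : ∀ i, Measurable (X i)) (hi : iIndepFun X P)
    {ν : Measure ℝ} (hν : ∀ i, P.map (X i) = ν) {g : ℝ → ℝ≥0∞} (hg : Measurable g) (n : ℕ) :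
    ∫⁻ ω, ∏ i : Fin n, g (X i ω) ∂P = (∫⁻ x, g x ∂ν) ^ n := by
  have h1 : iIndepFun (fun (i : Fin n) ω => g (X i ω)) P :=
    (hi.precomp Fin.val_injective).comp (fun _ => g) fun _ => hg
  rw [lintegral_prod_eq_prod_lintegral_of_indepFun Finset.univ _ h1 fun i => hg.comp (hX i)]
  have h2 : ∀ i, ∫⁻ ω, g (X i ω) ∂P = ∫⁻ x, g x ∂ν := fun i => by
    rw [← hν i, lintegral_map hg (hX i)]
  simp [h2]

lemma measurable_densityRatio {f : ℝ → ℝ} (hf : Measurable f) (hp₀ : Measurable p₀) :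
    Measurable fun x => ENNReal.ofReal (f x / p₀ x) := (hf.div hp₀).ennreal_ofReal

/-- Only an inequality, because `f` may charge the set where `p₀` vanishes. -/
lemma lintegral_densityRatio_mul_le {f : ℝ → ℝ} (hf : Measurable f) (hp₀ : Measurable p₀)
    {h : ℝ → ℝ≥0∞} (hh : Measurable h) :
    ∫⁻ x, ENNReal.ofReal (f x / p₀ x) * h x ∂densityMeasure p₀ ≤
      ∫⁻ x, h x ∂densityMeasure f := by
  rw [densityMeasure, densityMeasure,
    lintegral_withDensity_eq_lintegral_mul _ hp₀.ennreal_ofReal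
      (g := fun x => ENNReal.ofReal (f x / p₀ x) * h x)
      ((measurable_densityRatio hf hp₀).mul hh),
    lintegral_withDensity_eq_lintegral_mul _ hf.ennreal_ofReal hh]
  refine lintegral_mono fun x => ?_
  simp only [Pi.mul_apply]
  rw [← mul_assoc]
  gcongr
  rcases le_or_gt (p₀ x) 0 with hx | hx
  · simp [ENNReal.ofReal_of_nonpos hx]
  · rw [← ENNReal.ofReal_mul hx.le, mul_div_cancel₀ _ hx.ne']

/-- The Bernoulli moment generating function `1 + (e^s - 1) ν(B)`, bounded through `1 + y ≤ e^y`. It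
is used with `s = 1` for upper tails under `p₀` and `s = -1` for lower tails under the alternatives.
-/
lemma lintegral_exp_indicator (ν : Measure ℝ) [IsProbabilityMeasure ν] {B : Set ℝ}
    (hB : MeasurableSet B) (s : ℝ) :
    ∫⁻ x, ENNReal.ofReal (Real.exp (s * B.indicator 1 x)) ∂ν ≤
      ENNReal.ofReal (Real.exp ((Real.exp s - 1) * ν.real B)) := by
  have hc : ∀ x, Real.exp (s * B.indicator 1 x) = 1 + B.indicator (fun _ => Real.exp s - 1) x := by
    intro x
    by_cases hx : x ∈ B <;> simp [hx]
  have hi : Integrable (fun x => 1 + B.indicator (fun _ => Real.exp s - 1) x) ν :=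
    (integrable_const _).add ((integrable_const _).indicator hB)
  rw [← ofReal_integral_eq_lintegral_ofReal]
  · refine ENNReal.ofReal_le_ofReal ?_
    simp_rw [hc]
    rw [integral_add (integrable_const _) ((integrable_const _).indicator hB),
      integral_indicator_const _ hB]
    have := Real.add_one_le_exp ((Real.exp s - 1) * ν.real B)
    simp only [integral_const, probReal_univ, smul_eq_mul, mul_one]
    linarith
  · exact hi.congr (ae_of_all _ fun x => (hc x).symm)
  · exact ae_of_all _ fun x => (Real.exp_pos _).le

lemma measurable_sampleCount (hX : ∀ i, Measurable (X i)) {B : Set ℝ} (hB : MeasurableSet B)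
    (n : ℕ) : Measurable (sampleCount X B n) :=
  Finset.measurable_sum _ fun i _ => (measurable_one.indicator hB).comp (hX i)

lemma measurable_exp_mul_indicator {B : Set ℝ} (hB : MeasurableSet B) (s : ℝ) :
    Measurable fun x => ENNReal.ofReal (Real.exp (s * B.indicator 1 x)) :=
  (Real.measurable_exp.comp ((measurable_one.indicator hB).const_mul s)).ennreal_ofReal

lemma ofReal_exp_pow (y : ℝ) (n : ℕ) :
    ENNReal.ofReal (Real.exp y) ^ n = ENNReal.ofReal (Real.exp (n * y)) := by
  rw [← ENNReal.ofReal_pow (Real.exp_pos _).le, ← Real.exp_nat_mul]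

/-- Chernoff bound for the upper tail of a binomial count. -/
lemma measure_lt_sampleCount_le [IsProbabilityMeasure P] (hX : ∀ i, Measurable (X i))
    (hi : iIndepFun X P) {ν : Measure ℝ} [IsProbabilityMeasure ν] (hν : ∀ i, P.map (X i) = ν)
    {B : Set ℝ} (hB : MeasurableSet B) (n : ℕ) (c : ℝ) :
    P {ω | c < sampleCount X B n ω} ≤ ENNReal.ofReal (Real.exp (2 * n * ν.real B - c)) := by
  calc P {ω | c < sampleCount X B n ω}
      ≤ P {ω | 1 ≤ ENNReal.ofReal (Real.exp (-c)) *
          ENNReal.ofReal (Real.exp (1 * sampleCount X B n ω))} := by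
        refine measure_mono fun ω (hω : c < _) => ?_
        change (1 : ℝ≥0∞) ≤ _
        rw [← ENNReal.ofReal_mul (Real.exp_pos _).le, ← Real.exp_add, ENNReal.one_le_ofReal,
          Real.one_le_exp_iff]
        linarith
    _ ≤ ∫⁻ ω, ENNReal.ofReal (Real.exp (-c)) *
          ENNReal.ofReal (Real.exp (1 * sampleCount X B n ω)) ∂P := by
        have := mul_meas_ge_le_lintegral (μ := P)
          (((Real.measurable_exp.comp ((measurable_sampleCount hX hB n).const_mul
            1)).ennreal_ofReal).const_mul (ENNReal.ofReal (Real.exp (-c)))) 1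
        rwa [one_mul] at this
    _ = ENNReal.ofReal (Real.exp (-c)) *
          (∫⁻ x, ENNReal.ofReal (Real.exp (1 * B.indicator 1 x)) ∂ν) ^ n := by
        rw [lintegral_const_mul' _ _ ENNReal.ofReal_ne_top]
        simp_rw [ofReal_exp_mul_sampleCount]
        rw [lintegral_prod_iid hX hi hν (measurable_exp_mul_indicator hB 1)]
    _ ≤ ENNReal.ofReal (Real.exp (-c)) *
          ENNReal.ofReal (Real.exp ((Real.exp 1 - 1) * ν.real B)) ^ n := by
        gcongr
        exact lintegral_exp_indicator ν hB 1
    _ ≤ _ := by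
        rw [ofReal_exp_pow, ← ENNReal.ofReal_mul (Real.exp_pos _).le, ← Real.exp_add]
        refine ENNReal.ofReal_le_ofReal (Real.exp_le_exp.2 ?_)
        have h1 : Real.exp 1 - 1 ≤ 2 := by linarith [Real.exp_one_lt_d9]
        have h2 : 0 ≤ n * ν.real B := by positivity
        nlinarith

/-- Under a density `f`, a count in a set of large mass is unlikely to be small. -/
lemma lintegral_likelihood_mul_exp_neg_sampleCount_le [IsProbabilityMeasure P]
    (hX : ∀ i, Measurable (X i)) (hi : iIndepFun X P) (hp₀ : Measurable p₀)
    (hν : ∀ i, P.map (X i) = densityMeasure p₀) {f : ℝ → ℝ} (hf : Measurable f)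
    [IsProbabilityMeasure (densityMeasure f)] {B : Set ℝ} (hB : MeasurableSet B) (n : ℕ) (c : ℝ) :
    ∫⁻ ω, (∏ i : Fin n, ENNReal.ofReal (f (X i ω) / p₀ (X i ω))) *
        ENNReal.ofReal (Real.exp (c - sampleCount X B n ω)) ∂P ≤
      ENNReal.ofReal (Real.exp (c - n * ((densityMeasure f).real B / 2))) := by
  have h1 : ∀ ω, (∏ i : Fin n, ENNReal.ofReal (f (X i ω) / p₀ (X i ω))) *
        ENNReal.ofReal (Real.exp (c - sampleCount X B n ω)) =
      ENNReal.ofReal (Real.exp c) * ∏ i : Fin n, (ENNReal.ofReal (f (X i ω) / p₀ (X i ω)) *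
        ENNReal.ofReal (Real.exp (-1 * B.indicator 1 (X i ω)))) := by
    intro ω
    rw [Finset.prod_mul_distrib, ← ofReal_exp_mul_sampleCount, sub_eq_add_neg, Real.exp_add,
      ENNReal.ofReal_mul (Real.exp_pos _).le, neg_one_mul]
    ring
  simp_rw [h1]
  rw [lintegral_const_mul' _ _ ENNReal.ofReal_ne_top, lintegral_prod_iid hX hi hν
    (g := fun x => ENNReal.ofReal (f x / p₀ x) *
      ENNReal.ofReal (Real.exp (-1 * B.indicator 1 x)))
    ((measurable_densityRatio hf hp₀).mul (measurable_exp_mul_indicator hB (-1)))]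
  calc ENNReal.ofReal (Real.exp c) * (∫⁻ x, ENNReal.ofReal (f x / p₀ x) *
          ENNReal.ofReal (Real.exp (-1 * B.indicator 1 x)) ∂densityMeasure p₀) ^ n
      ≤ ENNReal.ofReal (Real.exp c) * ENNReal.ofReal
          (Real.exp ((Real.exp (-1) - 1) * (densityMeasure f).real B)) ^ n := by
        gcongr
        exact (lintegral_densityRatio_mul_le hf hp₀ (measurable_exp_mul_indicator hB (-1))).trans
          (lintegral_exp_indicator _ hB (-1))
    _ ≤ _ := by
        rw [ofReal_exp_pow, ← ENNReal.ofReal_mul (Real.exp_pos _).le, ← Real.exp_add]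
        refine ENNReal.ofReal_le_ofReal (Real.exp_le_exp.2 ?_)
        have h1 : Real.exp (-1) - 1 ≤ -(1 / 2) := by linarith [Real.exp_neg_one_lt_d9]
        have h2 : 0 ≤ n * (densityMeasure f).real B := by positivity
        nlinarith

lemma lintegral_likelihood_le_one [IsProbabilityMeasure P]
    (hX : ∀ i, Measurable (X i)) (hi : iIndepFun X P) (hp₀ : Measurable p₀)
    (hν : ∀ i, P.map (X i) = densityMeasure p₀) {f : ℝ → ℝ} (hf : Measurable f)
    [IsProbabilityMeasure (densityMeasure f)] (n : ℕ) :
    ∫⁻ ω, ∏ i : Fin n, ENNReal.ofReal (f (X i ω) / p₀ (X i ω)) ∂P ≤ 1 := by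
  rw [lintegral_prod_iid hX hi hν (measurable_densityRatio hf hp₀)]
  refine pow_le_one₀ zero_le ?_
  simpa using lintegral_densityRatio_mul_le hf hp₀ (h := fun _ => 1) measurable_const

/-- Chebyshev's inequality for a log-likelihood ratio. -/
lemma measure_two_mul_lt_sum_log_le [IsProbabilityMeasure P] (hX : ∀ i, Measurable (X i))
    (hi : iIndepFun X P) (hp₀ : Measurable p₀) (hν : ∀ i, P.map (X i) = densityMeasure p₀)
    [IsProbabilityMeasure (densityMeasure p₀)]
    {f : ℝ → ℝ} (hf : Measurable f) {ε : ℝ} (hε : 0 < ε) (hfK : f ∈ klNeighborhood p₀ ε)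
    {n : ℕ} (hn : 0 < n) :
    P {ω | 2 * (n * ε ^ 2) < ∑ i : Fin n, Real.log (p₀ (X i ω) / f (X i ω))} ≤
      ENNReal.ofReal (1 / (n * ε ^ 2)) := by
  obtain ⟨hL, hm1, hm2⟩ := hfK
  set g : ℝ → ℝ := fun x => Real.log (p₀ x / f x) with hg
  have hgm : Measurable g := Real.measurable_log.comp (hp₀.div hf)
  have hY : ∀ i : Fin n, MemLp (fun ω => g (X i ω)) 2 P := fun i => by
    rw [← hν i] at hL
    exact (memLp_map_measure_iff hgm.aestronglyMeasurable (hX i).aemeasurable).1 hL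
  have hind : iIndepFun (fun (i : Fin n) ω => g (X i ω)) P :=
    (hi.precomp Fin.val_injective).comp (fun _ => g) fun _ => hgm
  have hint : ∀ i : ℕ, ∫ ω, g (X i ω) ∂P = ∫ x, g x ∂densityMeasure p₀ := fun i => by
    rw [← hν i, integral_map (hX i).aemeasurable hgm.aestronglyMeasurable]
  have hint2 : ∀ i : ℕ, ∫ ω, g (X i ω) ^ 2 ∂P = ∫ x, g x ^ 2 ∂densityMeasure p₀ := fun i => by
    rw [← hν i, integral_map (hX i).aemeasurable (hgm.pow_const 2).aestronglyMeasurable]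
  have hvar : Var[∑ i : Fin n, (fun ω => g (X i ω)); P] ≤ n * ε ^ 2 := by
    rw [IndepFun.variance_sum (fun i _ => hY i) fun i _ j _ hij => hind.indepFun hij]
    calc ∑ i : Fin n, Var[fun ω => g (X i ω); P] ≤ ∑ _i : Fin n, ε ^ 2 := by
          refine Finset.sum_le_sum fun i _ => ?_
          refine (variance_le_expectation_sq (hY i).aestronglyMeasurable).trans ?_
          simp only [Pi.pow_apply]
          rw [hint2]
          exact hm2
      _ = n * ε ^ 2 := by simp
  have hmean : ∫ ω, (∑ i : Fin n, fun ω => g (X i ω)) ω ∂P ≤ n * ε ^ 2 := by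
    simp only [Finset.sum_apply]
    rw [integral_finsetSum _ fun i _ => (hY i).integrable one_le_two]
    calc ∑ i : Fin n, ∫ ω, g (X i ω) ∂P ≤ ∑ _i : Fin n, ε ^ 2 :=
          Finset.sum_le_sum fun i _ => (hint i).trans_le hm1
      _ = n * ε ^ 2 := by simp
  have hpos : 0 < n * ε ^ 2 := by positivity
  have hS : MemLp (∑ i : Fin n, fun ω => g (X i ω)) 2 P := memLp_finsetSum' _ fun i _ => hY i
  calc P {ω | 2 * (n * ε ^ 2) < ∑ i : Fin n, g (X i ω)}
      ≤ P {ω | n * ε ^ 2 ≤ |(∑ i : Fin n, fun ω => g (X i ω)) ω -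
          ∫ ω, (∑ i : Fin n, fun ω => g (X i ω)) ω ∂P|} := by
        refine measure_mono fun ω hω => ?_
        simp only [Finset.sum_apply, Set.mem_ofPred_eq] at hmean hω ⊢
        exact le_trans (by linarith) (le_abs_self _)
    _ ≤ ENNReal.ofReal (Var[∑ i : Fin n, (fun ω => g (X i ω)); P] / (n * ε ^ 2) ^ 2) :=
        meas_ge_le_variance_div_sq hS hpos
    _ ≤ ENNReal.ofReal (n * ε ^ 2 / (n * ε ^ 2) ^ 2) := by gcongr
    _ = _ := by
        congr 1
        field_simp

end IIDSample

/-! ### Lower bound for the evidence. -/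

lemma ae_forall_pos_of_map_eq_densityMeasure {Ω : Type*} [MeasurableSpace Ω] {P : Measure Ω}
    {X : ℕ → Ω → ℝ} {p₀ : ℝ → ℝ} (hX : ∀ i, Measurable (X i)) (hp₀ : Measurable p₀)
    (hν : ∀ i, P.map (X i) = densityMeasure p₀) : ∀ᵐ ω ∂P, ∀ i, 0 < p₀ (X i ω) := by
  refine ae_all_iff.2 fun i => ?_
  have hs : MeasurableSet {x | 0 < p₀ x} := measurableSet_lt measurable_const hp₀
  rw [← ae_map_iff (hX i).aemeasurable hs, hν i, densityMeasure,
    ae_withDensity_iff hp₀.ennreal_ofReal]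
  exact ae_of_all _ fun x hx => by simpa using hx

lemma ofReal_exp_neg_le_likelihood {Θ Ω : Type*} {f : Θ → ℝ → ℝ} {p₀ : ℝ → ℝ}
    {X : ℕ → Ω → ℝ} (hpos : ∀ θ x, 0 < f θ x) {n : ℕ} {θ : Θ} {ω : Ω} {c : ℝ}
    (hω : ∀ i, 0 < p₀ (X i ω))
    (hc : ∑ i : Fin n, Real.log (p₀ (X i ω) / f θ (X i ω)) ≤ c) :
    ENNReal.ofReal (Real.exp (-c)) ≤
      ∏ i : Fin n, ENNReal.ofReal (f θ (X i ω) / p₀ (X i ω)) := by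
  have h1 : ∀ i : Fin n, f θ (X i ω) / p₀ (X i ω) =
      Real.exp (-Real.log (p₀ (X i ω) / f θ (X i ω))) := fun i => by
    rw [Real.exp_neg, Real.exp_log (div_pos (hω i) (hpos _ _)), inv_div]
  simp_rw [h1]
  rw [← ENNReal.ofReal_prod_of_nonneg fun i _ => (Real.exp_pos _).le, ← Real.exp_sum,
    Finset.sum_neg_distrib]
  exact ENNReal.ofReal_le_ofReal (Real.exp_le_exp.2 (neg_le_neg hc))

section RandomDensity

variable {Θ : Type*} [MeasurableSpace Θ] {f : Θ → ℝ → ℝ} {p₀ : ℝ → ℝ}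

lemma Measurable.of_uncurry_comp_left (hf : Measurable (Function.uncurry f)) (θ : Θ) :
    Measurable (f θ) := hf.comp measurable_prodMk_left

lemma measurableSet_klNeighborhood (hf : Measurable (Function.uncurry f)) (hp₀ : Measurable p₀)
    [IsProbabilityMeasure (densityMeasure p₀)] (ε : ℝ) :
    MeasurableSet {θ | f θ ∈ klNeighborhood p₀ ε} := by
  have hm : Measurable (Function.uncurry fun θ x => Real.log (p₀ x / f θ x)) :=
    Real.measurable_log.comp ((hp₀.comp measurable_snd).div hf)
  have hm2 : Measurable (Function.uncurry fun θ x => Real.log (p₀ x / f θ x) ^ 2) :=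
    hm.pow_const 2
  have h1 : ∀ θ, MemLp (fun x => Real.log (p₀ x / f θ x)) 2 (densityMeasure p₀) ↔
      Integrable (fun x => Real.log (p₀ x / f θ x) ^ 2) (densityMeasure p₀) := fun θ =>
    memLp_two_iff_integrable_sq (hm.comp measurable_prodMk_left).aestronglyMeasurable
  have hI := _root_.measurableSet_integrable (μ := densityMeasure p₀) hm2.stronglyMeasurable
  have hI1 := measurableSet_le
    (hm.stronglyMeasurable.integral_prod_right (ν := densityMeasure p₀)).measurable
    (measurable_const (a := ε ^ 2))
  have hI2 := measurableSet_le
    (hm2.stronglyMeasurable.integral_prod_right (ν := densityMeasure p₀)).measurable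
    (measurable_const (a := ε ^ 2))
  convert hI.inter (hI1.inter hI2) using 1
  ext θ
  exact and_congr_left' (h1 θ)

lemma measurable_densityMeasure_apply (hf : Measurable (Function.uncurry f)) {s : Set ℝ}
    (hs : MeasurableSet s) : Measurable fun θ => densityMeasure (f θ) s := by
  simp only [densityMeasure, withDensity_apply _ hs]
  exact Measurable.lintegral_prod_right (f := fun θ x => ENNReal.ofReal (f θ x)) hf.ennreal_ofReal

variable {Ω : Type*} [MeasurableSpace Ω] {X : ℕ → Ω → ℝ}

lemma measurable_likelihood (hf : Measurable (Function.uncurry f)) (hp₀ : Measurable p₀)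
    (hX : ∀ i, Measurable (X i)) (n : ℕ) :
    Measurable fun q : Θ × Ω =>
      ∏ i : Fin n, ENNReal.ofReal (f q.1 (X i q.2) / p₀ (X i q.2)) :=
  Finset.measurable_prod _ fun i _ =>
    ((hf.comp (measurable_fst.prodMk ((hX i).comp measurable_snd))).div
      (hp₀.comp ((hX i).comp measurable_snd))).ennreal_ofReal

variable {P : Measure Ω} [IsProbabilityMeasure P] {D : Measure Θ} [IsProbabilityMeasure D]

/-- The evidence is not much smaller than the prior mass of a Kullback–Leibler neighborhood. -/
lemma measure_integratedLikelihood_univ_lt_le (hf : Measurable (Function.uncurry f))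
    (hpos : ∀ θ x, 0 < f θ x) (hp₀ : Measurable p₀) [IsProbabilityMeasure (densityMeasure p₀)]
    (hX : ∀ i, Measurable (X i)) (hi : iIndepFun X P)
    (hν : ∀ i, P.map (X i) = densityMeasure p₀) {ε : ℝ} (hε : 0 < ε) {n : ℕ} (hn : 0 < n)
    (hK : D {θ | f θ ∈ klNeighborhood p₀ ε} ≠ 0) :
    P {ω | integratedLikelihood D f p₀ (fun i : Fin n => X i ω) Set.univ <
        ENNReal.ofReal (Real.exp (-(2 * (n * ε ^ 2)))) *
          (D {θ | f θ ∈ klNeighborhood p₀ ε} / 2)} ≤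
      2 * ENNReal.ofReal (1 / (n * ε ^ 2)) := by
  set κ := {θ | f θ ∈ klNeighborhood p₀ ε} with hκ
  have hκm : MeasurableSet κ := measurableSet_klNeighborhood hf hp₀ ε
  set S : Set (Θ × Ω) :=
    {q | 2 * (n * ε ^ 2) < ∑ i : Fin n, Real.log (p₀ (X i q.2) / f q.1 (X i q.2))} with hS
  have hSm : MeasurableSet S := by
    refine measurableSet_lt measurable_const (Finset.measurable_sum _ fun i _ => ?_)
    exact Real.measurable_log.comp ((hp₀.comp ((hX i).comp measurable_snd)).div
      (hf.comp (measurable_fst.prodMk ((hX i).comp measurable_snd))))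
  set δ := ENNReal.ofReal (1 / (n * ε ^ 2)) with hδ
  -- The prior mass of those parameters in the neighbourhood whose log-likelihood ratio is too
  -- unfavourable at `ω`. Fubini and Chebyshev bound its mean by `δ * D κ`, and Markov's inequality
  -- then makes it less than half of `D κ` outside probability `2 * δ`.
  set b : Ω → ℝ≥0∞ := fun ω => (D.restrict κ) ((fun θ => (θ, ω)) ⁻¹' S) with hb
  have hbm : Measurable b := measurable_measure_prodMk_right hSm
  have hbint : ∫⁻ ω, b ω ∂P ≤ δ * D κ := by
    rw [hb, ← Measure.prod_apply_symm hSm, Measure.prod_apply hSm]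
    calc ∫⁻ θ in κ, P (Prod.mk θ ⁻¹' S) ∂D ≤ ∫⁻ _ in κ, δ ∂D := by
          refine setLIntegral_mono' hκm fun θ hθ => ?_
          exact measure_two_mul_lt_sum_log_le hX hi hp₀ hν (hf.of_uncurry_comp_left θ) hε hθ hn
      _ = δ * D κ := by simp
  have hb2 : P {ω | D κ / 2 ≤ b ω} ≤ 2 * δ := by
    have h1 := (mul_meas_ge_le_lintegral hbm (D κ / 2)).trans hbint
    have h0 : D κ / 2 ≠ 0 := by simp [hK]
    have htop : D κ / 2 ≠ ⊤ := ENNReal.div_ne_top (measure_ne_top _ _) two_ne_zero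
    rw [← ENNReal.mul_le_mul_iff_right h0 htop]
    refine h1.trans (le_of_eq ?_)
    rw [← mul_assoc, ENNReal.div_mul_cancel two_ne_zero ENNReal.ofNat_ne_top, mul_comm]
  refine le_trans (measure_mono_ae ?_) hb2
  filter_upwards [ae_forall_pos_of_map_eq_densityMeasure hX hp₀ hν] with ω hω hlt
  change _ < _ at hlt
  change D κ / 2 ≤ b ω
  by_contra! hlt2
  set T := (fun θ => (θ, ω)) ⁻¹' S with hT
  have hTm : MeasurableSet T := hSm.preimage measurable_prodMk_right
  have hsplit : D.restrict κ T + D.restrict κ Tᶜ = D κ := by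
    rw [measure_add_measure_compl hTm, Measure.restrict_apply_univ]
  -- The other half of the neighbourhood has likelihood ratio at least `e^(-2nε²)`, which alone
  -- bounds the evidence from below.
  have hgood : D κ / 2 ≤ D.restrict κ Tᶜ := by
    by_contra! h
    have := ENNReal.add_lt_add hlt2 h
    rw [hb] at this
    simp only [← hT, hsplit, ENNReal.add_halves, lt_self_iff_false] at this
  refine absurd hlt (not_lt.2 ?_)
  calc ENNReal.ofReal (Real.exp (-(2 * (n * ε ^ 2)))) * (D κ / 2)
      ≤ ENNReal.ofReal (Real.exp (-(2 * (n * ε ^ 2)))) * D.restrict κ Tᶜ := by gcongr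
    _ ≤ ENNReal.ofReal (Real.exp (-(2 * (n * ε ^ 2)))) * D Tᶜ := by
        exact mul_le_mul_right (Measure.restrict_apply_le _ _) _
    _ = ∫⁻ _ in Tᶜ, ENNReal.ofReal (Real.exp (-(2 * (n * ε ^ 2)))) ∂D := by simp
    _ ≤ ∫⁻ θ in Tᶜ, ∏ i : Fin n, ENNReal.ofReal (f θ (X i ω) / p₀ (X i ω)) ∂D := by
        refine setLIntegral_mono' hTm.compl fun θ hθ => ?_
        exact ofReal_exp_neg_le_likelihood hpos hω (not_lt.1 hθ)
    _ ≤ integratedLikelihood D f p₀ (fun i : Fin n => X i ω) Set.univ := by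
        unfold integratedLikelihood
        exact lintegral_mono_set (fun θ _ => Set.mem_univ _)

lemma lintegral_lintegral_likelihood_swap (hf : Measurable (Function.uncurry f))
    (hp₀ : Measurable p₀) (hX : ∀ i, Measurable (X i)) (n : ℕ) (U : Set Θ) {h : Ω → ℝ≥0∞}
    (hh : Measurable h) :
    ∫⁻ ω, ∫⁻ θ in U, (∏ i : Fin n, ENNReal.ofReal (f θ (X i ω) / p₀ (X i ω))) * h ω ∂D ∂P =
      ∫⁻ θ in U, ∫⁻ ω, (∏ i : Fin n, ENNReal.ofReal (f θ (X i ω) / p₀ (X i ω))) * h ω ∂P ∂D :=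
  lintegral_lintegral_swap (f := fun ω θ =>
    (∏ i : Fin n, ENNReal.ofReal (f θ (X i ω) / p₀ (X i ω))) * h ω)
    (((measurable_likelihood hf hp₀ hX n).comp measurable_swap).mul
      (hh.comp measurable_fst)).aemeasurable

end RandomDensity

/-! ### Dyadic shells, the rate, and the prior mass of far shells. -/

lemma measurableSet_dyadicShell : ∀ m, MeasurableSet (dyadicShell m)
  | 0 => measurableSet_Ioc
  | _ + 1 => measurableSet_Ioc.diff measurableSet_Ioc

/-- The slack `- 1` makes one formula cover `m = 0`, where the bound is negative. -/
lemma dyadicShell_subset (m : ℕ) : dyadicShell m ⊆ {x | 2 ^ m / 2 - 1 ≤ |x|} := by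
  intro x hx
  change (2 : ℝ) ^ m / 2 - 1 ≤ |x|
  cases m with
  | zero =>
    have := abs_nonneg x
    norm_num
    linarith
  | succ m =>
    have h := hx.2
    have h2 : (2 : ℝ) ^ m ≤ |x| := by
      by_contra! hc
      exact h ⟨(abs_lt.1 hc).1, (abs_lt.1 hc).2.le⟩
    rw [pow_succ]
    linarith

/-- Makes the set of near shells finite, with at most `n` members. `n ≥ 3` ensures `log n ≥ 1`, so
that `2^m ≤ 2^(pm) ≤ n`. -/
lemma lt_of_sq_le_two_rpow {p ε : ℝ} (hp : 1 ≤ p) {n m : ℕ} (hn : 3 ≤ n)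
    (hε : Real.log n / n ≤ ε ^ 2) (hm : ε ^ 2 ≤ (2 : ℝ) ^ (-(p * m))) : m < n := by
  have hn0 : (0 : ℝ) < n := by positivity
  have hlog : 1 ≤ Real.log n := by
    rw [Real.le_log_iff_exp_le hn0]
    have : (3 : ℝ) ≤ n := by exact_mod_cast hn
    linarith [Real.exp_one_lt_d9]
  have h1 : 1 / (n : ℝ) ≤ (2 : ℝ) ^ (-(p * m)) :=
    (div_le_div_of_nonneg_right hlog hn0.le).trans (hε.trans hm)
  have h2 : (2 : ℝ) ^ (-(p * m)) ≤ ((2 : ℝ) ^ m)⁻¹ := by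
    rw [← Real.rpow_natCast, ← Real.rpow_neg zero_le_two]
    refine Real.rpow_le_rpow_of_exponent_le one_le_two ?_
    have : (0 : ℝ) ≤ m := by positivity
    nlinarith
  have h3 := h1.trans h2
  rw [one_div, inv_le_inv₀ hn0 (by positivity)] at h3
  have h4 : 2 ^ m ≤ n := by exact_mod_cast h3
  exact m.lt_two_pow_self.trans_le h4

/-- With `w = n^(1/(1+p))` the rate satisfies `ε² ≤ a² w^(-p)`, hence `n ε² ≤ a² w`. Far shells then
have `w^p ≤ a² 2^(pm) ≤ (a² 2^m)^p`, using `a ≥ 1` and `p ≥ 1`; the two factors `a²` produce the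
fourth power. -/
lemma mul_sq_le_of_two_rpow_lt {p ε A : ℝ} (hp : 1 ≤ p) (hε0 : 0 < ε) {n m : ℕ} (hn : 0 < n)
    (hε : ε ≤ A * (n : ℝ) ^ (-(p / (2 + 2 * p)))) (hm : (2 : ℝ) ^ (-(p * m)) < ε ^ 2) :
    n * ε ^ 2 ≤ max A 1 ^ 4 * 2 ^ m := by
  have hn0 : (0 : ℝ) < n := by positivity
  have hp1 : (0 : ℝ) < 1 + p := by linarith
  set a := max A 1
  have ha : 1 ≤ a := le_max_right _ _
  set w : ℝ := (n : ℝ) ^ (1 / (1 + p)) with hw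
  have hw0 : 0 < w := by positivity
  have hwp : w * w ^ p = n := by
    rw [← Real.rpow_one_add' hw0.le (by linarith), hw, ← Real.rpow_mul hn0.le,
      one_div_mul_cancel hp1.ne', Real.rpow_one]
  have hsq : ((n : ℝ) ^ (-(p / (2 + 2 * p)))) ^ 2 = (w ^ p)⁻¹ := by
    rw [← Real.rpow_natCast, ← Real.rpow_mul hn0.le, ← Real.rpow_neg hw0.le, hw,
      ← Real.rpow_mul hn0.le]
    congr 1
    push_cast
    field_simp
  have h1 : ε ^ 2 ≤ a ^ 2 * (w ^ p)⁻¹ := by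
    rw [← hsq, ← mul_pow]
    exact pow_le_pow_left₀ hε0.le (hε.trans (by gcongr; exact le_max_left _ _)) 2
  have hwp0 : 0 < w ^ p := by positivity
  have h2 : n * ε ^ 2 ≤ a ^ 2 * w := by
    calc n * ε ^ 2 ≤ n * (a ^ 2 * (w ^ p)⁻¹) := by gcongr
      _ = a ^ 2 * w := by
        rw [← hwp]
        field_simp
  have h3 : w ≤ a ^ 2 * 2 ^ m := by
    rw [← Real.rpow_le_rpow_iff hw0.le (by positivity) (by linarith : 0 < p),
      Real.mul_rpow (by positivity) (by positivity)]
    have h4 := hm.le.trans h1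
    have h5 : (2 : ℝ) ^ (-(p * m)) = (((2 : ℝ) ^ m) ^ p)⁻¹ := by
      rw [← Real.rpow_natCast, ← Real.rpow_mul zero_le_two, ← Real.rpow_neg zero_le_two, mul_comm p]
    have hy0 : 0 < ((2 : ℝ) ^ m) ^ p := by positivity
    rw [h5, ← div_eq_mul_inv, le_div_iff₀ hwp0, inv_mul_le_iff₀ hy0] at h4
    rw [mul_comm]
    refine h4.trans ?_
    gcongr
    exact Real.self_le_rpow_of_one_le (one_le_pow₀ ha) hp
  calc n * ε ^ 2 ≤ a ^ 2 * w := h2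
    _ ≤ a ^ 2 * (a ^ 2 * 2 ^ m) := by gcongr
    _ = a ^ 4 * 2 ^ m := by ring

lemma natCast_le_two_pow (m : ℕ) : (m : ℝ) ≤ 2 ^ m := by
  exact_mod_cast m.lt_two_pow_self.le

/-- A Dirichlet process mixture of normals rarely puts much mass on a far shell. -/
lemma IsDirichletProcess.measure_lt_densityMeasure_dyadicShell_le {α : ℝ} (hα : 1 < α) {μH : ℝ}
    {vH : ℝ≥0} {D : Measure (ProbabilityMeasure ℝ)}
    (h : IsDirichletProcess α (gaussianReal μH vH) D) {σ : ℝ≥0} (hσ : 0 < σ) (hσ1 : σ ≤ 1)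
    {p K' a u : ℝ} (hp : 0 ≤ p) (hK' : 1 ≤ K') (ha : 0 ≤ a) {m : ℕ} (hu : u ≤ a * 2 ^ m) {t : ℝ}
    (ht : t = 8 * a + 2 * p + 2) :
    D {G | ENNReal.ofReal (K' * 2 ^ (-(p * m))) <
        densityMeasure (normalMixture σ G) (dyadicShell m)} ≤
      ENNReal.ofReal (2 * α / (α - 1) * (2 * Real.exp (|μH| * t + (vH + 1) * t ^ 2 / 2 + t)) *
        Real.exp (-(4 * u)) * (1 / 2) ^ m) := by
  have hα1 : 0 < α - 1 := by linarith
  have ht0 : 0 ≤ t := by rw [ht]; positivity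
  set r : ℝ := K' * 2 ^ (-(p * m)) with hr
  have hr0 : 0 < r := by positivity
  have hmeas := measurable_densityMeasure_apply (measurable_normalMixture σ)
    (measurableSet_dyadicShell m)
  have h1 : ENNReal.ofReal r * D {G | ENNReal.ofReal r <
        densityMeasure (normalMixture σ G) (dyadicShell m)} ≤
      ENNReal.ofReal (2 * α / (α - 1)) * ENNReal.ofReal (2 * Real.exp (|μH| * t +
        (vH + σ ^ 2 : ℝ≥0) * t ^ 2 / 2 - t * (2 ^ m / 2 - 1))) :=
    calc _ ≤ ENNReal.ofReal r * D {G | ENNReal.ofReal r ≤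
        densityMeasure (normalMixture σ G) (dyadicShell m)} := by
          gcongr with G
          exact le_of_lt
      _ ≤ ∫⁻ G, densityMeasure (normalMixture σ G) (dyadicShell m) ∂D :=
          mul_meas_ge_le_lintegral hmeas _
      _ ≤ _ := h.lintegral_densityMeasure_normalMixture_le hα hσ (measurableSet_dyadicShell m)
      _ ≤ _ := by
          gcongr
          exact (measure_mono (dyadicShell_subset m)).trans (gaussianReal_le_abs_le _ _ ht0 _)
  rw [← ENNReal.ofReal_mul (by positivity)] at h1
  rw [mul_comm] at h1
  rw [← ENNReal.le_div_iff_mul_le (by simp [hr0]) (by simp), ← ENNReal.ofReal_div_of_pos hr0] at h1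
  refine h1.trans (ENNReal.ofReal_le_ofReal ?_)
  have hσ2 : ((vH + σ ^ 2 : ℝ≥0) : ℝ) ≤ vH + 1 := by
    have : σ ^ 2 ≤ 1 := pow_le_one' hσ1 2
    exact_mod_cast add_le_add_right this vH
  have hlog2 : Real.log 2 ≤ 1 := by linarith [Real.log_two_lt_d9]
  have hlog0 : 0 ≤ Real.log 2 := (Real.log_pos one_lt_two).le
  have hmy := natCast_le_two_pow m
  have hm0 : (0 : ℝ) ≤ m := by positivity
  set y : ℝ := 2 ^ m with hy
  have hmlog : m * Real.log 2 ≤ y := by nlinarith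
  have hrinv : r⁻¹ ≤ Real.exp (p * y) := by
    rw [hr, mul_inv, ← Real.rpow_neg zero_le_two, neg_neg, Real.rpow_def_of_pos zero_lt_two]
    calc K'⁻¹ * Real.exp (Real.log 2 * (p * m)) ≤ 1 * Real.exp (Real.log 2 * (p * m)) := by
          gcongr
          exact inv_le_one_of_one_le₀ hK'
      _ ≤ Real.exp (p * y) := by
          rw [one_mul]
          exact Real.exp_le_exp.2 (by nlinarith)
  have hhalf : Real.exp (-y) ≤ (1 / 2) ^ m := by
    rw [one_div, inv_pow, Real.exp_neg]
    refine inv_anti₀ (by positivity) ?_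
    linarith [Real.add_one_le_exp y]
  calc 2 * α / (α - 1) * (2 * Real.exp (|μH| * t + (vH + σ ^ 2 : ℝ≥0) * t ^ 2 / 2 -
        t * (y / 2 - 1))) / r
      = 2 * α / (α - 1) * (2 * (Real.exp (|μH| * t + (vH + σ ^ 2 : ℝ≥0) * t ^ 2 / 2 -
        t * (y / 2 - 1)) * r⁻¹)) := by ring
    _ ≤ 2 * α / (α - 1) * (2 * (Real.exp (|μH| * t + (vH + 1) * t ^ 2 / 2 -
        t * (y / 2 - 1)) * Real.exp (p * y))) := by gcongr
    _ ≤ 2 * α / (α - 1) * (2 * (Real.exp (|μH| * t + (vH + 1) * t ^ 2 / 2 + t) *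
        Real.exp (-(4 * u)) * Real.exp (-y))) := by
        rw [← Real.exp_add, ← Real.exp_add, ← Real.exp_add]
        refine mul_le_mul_of_nonneg_left (mul_le_mul_of_nonneg_left (Real.exp_le_exp.2 ?_)
          zero_le_two) (by positivity)
        -- The choice of `t` splits `t y / 2` into three: `4 a y` pays for `e^(-4u)`, `p y` cancels
        -- the Markov factor `1 / r`, and `y` leaves a summable `e^(-y)`.
        have hty : t * y = 8 * (a * y) + 2 * (p * y) + 2 * y := by rw [ht]; ring
        linarith
    _ ≤ 2 * α / (α - 1) * (2 * (Real.exp (|μH| * t + (vH + 1) * t ^ 2 / 2 + t) *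
        Real.exp (-(4 * u)) * (1 / 2) ^ m)) := by gcongr
    _ = _ := by ring

/-! ### From evidence, tests and prior mass to the posterior. -/

section Posterior

variable {Θ : Type*} [MeasurableSpace Θ] {D : Measure Θ} {f : Θ → ℝ → ℝ} {p₀ : ℝ → ℝ}

/-- The posterior masses of `A` and its complement add to `1` only if the evidence is neither `0`
nor `⊤`, where `ℝ≥0∞` division degenerates; hence `h0` and `htop`. -/
lemma ofReal_mul_integratedLikelihood_univ_le {A : Set (ℝ → ℝ)} (hA : MeasurableSet {θ | f θ ∈ A})
    {n : ℕ} {x : Fin n → ℝ} {δ : ℝ} (h0 : integratedLikelihood D f p₀ x Set.univ ≠ 0)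
    (htop : integratedLikelihood D f p₀ x Set.univ ≠ ⊤)
    (h : δ ≤ |posteriorProb D f p₀ x A - 1|) :
    ENNReal.ofReal δ * integratedLikelihood D f p₀ x Set.univ ≤
      ∫⁻ θ in {θ | f θ ∈ A}ᶜ, ∏ i, ENNReal.ofReal (f θ (x i) / p₀ (x i)) ∂D := by
  set I := integratedLikelihood D f p₀ x Set.univ with hI
  set J := ∫⁻ θ in {θ | f θ ∈ A}ᶜ, ∏ i, ENNReal.ofReal (f θ (x i) / p₀ (x i)) ∂D with hJ
  have hadd : integratedLikelihood D f p₀ x A + J = I := by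
    rw [hI, hJ, integratedLikelihood, lintegral_add_compl _ hA, integratedLikelihood]
    simp
  have hdiv : integratedLikelihood D f p₀ x A / I + J / I = 1 := by
    rw [← ENNReal.add_div, hadd, ENNReal.div_self h0 htop]
  have hA1 : integratedLikelihood D f p₀ x A / I ≠ ⊤ :=
    ne_top_of_le_ne_top ENNReal.one_ne_top (hdiv ▸ le_self_add)
  have hJ1 : J / I ≠ ⊤ := ne_top_of_le_ne_top ENNReal.one_ne_top (hdiv ▸ le_add_self)
  have hreal : posteriorProb D f p₀ x A + (J / I).toReal = 1 := by
    rw [posteriorProb, ← hI, ← ENNReal.toReal_add hA1 hJ1, hdiv, ENNReal.toReal_one]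
  have habs : |posteriorProb D f p₀ x A - 1| = (J / I).toReal := by
    rw [abs_sub_comm, ← hreal, add_sub_cancel_left, abs_of_nonneg ENNReal.toReal_nonneg]
  rw [habs] at h
  rw [← ENNReal.le_div_iff_mul_le (Or.inl h0) (Or.inl htop)]
  exact ENNReal.ofReal_le_of_le_toReal h

variable {Ω : Type*} [MeasurableSpace Ω] {P : Measure Ω} [IsProbabilityMeasure P]
  [IsProbabilityMeasure D] {X : ℕ → Ω → ℝ}

lemma ae_integratedLikelihood_univ_ne_top (hf : Measurable (Function.uncurry f))
    (hp₀ : Measurable p₀) (hfd : ∀ θ, IsProbabilityMeasure (densityMeasure (f θ)))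
    (hX : ∀ i, Measurable (X i)) (hi : iIndepFun X P)
    (hν : ∀ i, P.map (X i) = densityMeasure p₀) (n : ℕ) :
    ∀ᵐ ω ∂P, integratedLikelihood D f p₀ (fun i : Fin n => X i ω) Set.univ ≠ ⊤ := by
  have hswap := lintegral_lintegral_likelihood_swap (P := P) (D := D) hf hp₀ hX n Set.univ
    (h := fun _ => 1) measurable_const
  simp only [mul_one, Measure.restrict_univ] at hswap
  have hle : ∫⁻ ω, ∫⁻ θ, ∏ i : Fin n, ENNReal.ofReal (f θ (X i ω) / p₀ (X i ω)) ∂D ∂P ≤ 1 := by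
    rw [hswap]
    calc _ ≤ ∫⁻ _, 1 ∂D := lintegral_mono fun θ => by
          have := hfd θ
          exact lintegral_likelihood_le_one hX hi hp₀ hν (hf.of_uncurry_comp_left θ) n
      _ = 1 := by simp
  have hm : Measurable fun ω => ∫⁻ θ, ∏ i : Fin n, ENNReal.ofReal (f θ (X i ω) / p₀ (X i ω)) ∂D :=
    (measurable_likelihood hf hp₀ hX n).lintegral_prod_left'
  filter_upwards [ae_lt_top hm (hle.trans_lt ENNReal.one_lt_top).ne] with ω hω
  simpa [integratedLikelihood] using hω.ne

/-- A nonasymptotic bound for the posterior probability of the complement of `A`, when this is a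
union of sets `U m` that can be tested by counts in `B m`, for `m ∈ S`, or have small prior mass. -/
lemma measure_le_abs_posteriorProb_sub_one_le (hf : Measurable (Function.uncurry f))
    (hp₀ : Measurable p₀) (hfd : ∀ θ, IsProbabilityMeasure (densityMeasure (f θ)))
    (hX : ∀ i, Measurable (X i)) (hi : iIndepFun X P)
    (hν : ∀ i, P.map (X i) = densityMeasure p₀) {n : ℕ} {A : Set (ℝ → ℝ)}
    (hA : MeasurableSet {θ | f θ ∈ A}) {U : ℕ → Set Θ} (hU : {θ | f θ ∈ A}ᶜ ⊆ ⋃ m, U m)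
    (hUm : ∀ m, MeasurableSet (U m)) {B : ℕ → Set ℝ} (hB : ∀ m, MeasurableSet (B m))
    (S : Finset ℕ) (c : ℕ → ℝ) {η ρ : ℝ≥0∞} (hη : η ≠ 0) {δ : ℝ} (hδ : 0 < δ)
    (hρS : ∀ m ∈ S, ∀ θ ∈ U m,
      ENNReal.ofReal (Real.exp (c m - n * ((densityMeasure (f θ)).real (B m) / 2))) ≤ ρ)
    (hη' : η ≠ ⊤) {τ : ℕ → ℝ≥0∞} (hτ : ∀ m ∉ S, D (U m) ≤ τ m) :
    P {ω | δ ≤ |posteriorProb D f p₀ (fun i : Fin n => X i ω) A - 1|} ≤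
      P {ω | integratedLikelihood D f p₀ (fun i : Fin n => X i ω) Set.univ < η} +
        ∑ m ∈ S, P {ω | c m < sampleCount X (B m) n ω} +
        (S.card * ρ + ∑' m, τ m) / (ENNReal.ofReal δ * η) := by
  classical
  -- A smooth substitute for a test: the weight is at least `1` when the count is at most `c m`, so
  -- inserting it can only increase the numerator there, while its expectation under densities in `U
  -- m` is small. Shells outside `S` get weight `1` and rely on prior mass.
  set h : ℕ → Ω → ℝ≥0∞ := fun m ω =>
    if m ∈ S then ENNReal.ofReal (Real.exp (c m - sampleCount X (B m) n ω)) else 1 with hh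
  have hhm : ∀ m, Measurable (h m) := fun m => by
    by_cases hm : m ∈ S
    · simp only [hh, hm, if_true]
      exact (Real.measurable_exp.comp
        ((measurable_sampleCount hX (hB m) n).const_sub (c m))).ennreal_ofReal
    · simp only [hh, hm, if_false]
      exact measurable_const
  set R : Ω → ℝ≥0∞ := fun ω => ∑' m, ∫⁻ θ in U m,
    (∏ i : Fin n, ENNReal.ofReal (f θ (X i ω) / p₀ (X i ω))) * h m ω ∂D with hR
  have hRm : ∀ m, Measurable fun ω => ∫⁻ θ in U m,
      (∏ i : Fin n, ENNReal.ofReal (f θ (X i ω) / p₀ (X i ω))) * h m ω ∂D := fun m =>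
    ((measurable_likelihood hf hp₀ hX n).mul
      ((hhm m).comp measurable_snd)).lintegral_prod_left' (μ := D.restrict (U m))
  have hterm : ∀ m, ∫⁻ ω, ∫⁻ θ in U m,
      (∏ i : Fin n, ENNReal.ofReal (f θ (X i ω) / p₀ (X i ω))) * h m ω ∂D ∂P ≤
        (if m ∈ S then ρ else 0) + τ m := by
    intro m
    rw [lintegral_lintegral_likelihood_swap hf hp₀ hX n (U m) (hhm m)]
    by_cases hm : m ∈ S
    · simp only [hh, hm, if_true]
      calc _ ≤ ∫⁻ _ in U m, ρ ∂D := by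
            refine setLIntegral_mono' (hUm m) fun θ hθ => ?_
            have := hfd θ
            exact (lintegral_likelihood_mul_exp_neg_sampleCount_le hX hi hp₀ hν
              (hf.of_uncurry_comp_left θ) (hB m) n (c m)).trans (hρS m hm θ hθ)
        _ = ρ * D (U m) := by simp
        _ ≤ ρ * 1 := by
            gcongr
            exact prob_le_one
        _ ≤ ρ + τ m := by rw [mul_one]; exact le_self_add
    · simp only [hh, hm, if_false, mul_one, zero_add]
      calc _ ≤ ∫⁻ _ in U m, 1 ∂D := by
            refine lintegral_mono fun θ => ?_
            have := hfd θ
            exact lintegral_likelihood_le_one hX hi hp₀ hν (hf.of_uncurry_comp_left θ) n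
        _ = D (U m) := by simp
        _ ≤ τ m := hτ m hm
  have hRint : ∫⁻ ω, R ω ∂P ≤ S.card * ρ + ∑' m, τ m := by
    rw [hR, lintegral_tsum fun m => (hRm m).aemeasurable]
    refine (ENNReal.tsum_le_tsum hterm).trans (le_of_eq ?_)
    rw [ENNReal.tsum_add]
    congr 1
    rw [tsum_eq_sum (s := S) fun m hm => by simp [hm], Finset.sum_ite_mem, Finset.inter_self,
      Finset.sum_const, nsmul_eq_mul]
  have hsub : P {ω | δ ≤ |posteriorProb D f p₀ (fun i : Fin n => X i ω) A - 1|} ≤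
      P (({ω | integratedLikelihood D f p₀ (fun i : Fin n => X i ω) Set.univ < η} ∪
        ⋃ m ∈ S, {ω | c m < sampleCount X (B m) n ω}) ∪ {ω | ENNReal.ofReal δ * η ≤ R ω}) := by
    refine measure_mono_ae ?_
    filter_upwards [ae_integratedLikelihood_univ_ne_top (D := D) hf hp₀ hfd hX hi hν n]
      with ω htop hω
    by_contra hcon
    change ¬ ((_ ∨ ω ∈ ⋃ m ∈ S, {ω | c m < sampleCount X (B m) n ω}) ∨ _) at hcon
    push Not at hcon
    obtain ⟨⟨hc1, hc2⟩, hc3⟩ := hcon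
    replace hc1 : η ≤ integratedLikelihood D f p₀ (fun i : Fin n => X i ω) Set.univ := by
      by_contra! hlt
      exact hc1 hlt
    refine hc3 (le_trans ?_ ((ofReal_mul_integratedLikelihood_univ_le hA
      (fun h0 => hη (le_zero_iff.1 (h0 ▸ hc1))) htop hω).trans ?_))
    · gcongr
    · refine (lintegral_mono_set hU).trans ((lintegral_iUnion_le _ _).trans ?_)
      refine ENNReal.tsum_le_tsum fun m => lintegral_mono fun θ => ?_
      refine le_mul_of_one_le_right zero_le ?_
      by_cases hm : m ∈ S
      · simp only [hh, hm, if_true, ENNReal.one_le_ofReal, Real.one_le_exp_iff, sub_nonneg]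
        by_contra! hlt
        exact hc2 (Set.mem_iUnion₂.2 ⟨m, hm, hlt⟩)
      · simp [hh, hm]
  refine hsub.trans ((measure_union_le _ _).trans ?_)
  gcongr
  · refine (measure_union_le _ _).trans ?_
    gcongr
    exact measure_biUnion_finset_le _ _
  · have hδη : ENNReal.ofReal δ * η ≠ 0 := by simp [hδ, hη]
    refine (meas_ge_le_lintegral_div (Measurable.tsum hRm).aemeasurable hδη
      (ENNReal.mul_ne_top ENNReal.ofReal_ne_top hη')).trans ?_
    gcongr

end Posterior

/-! ### Choice of constants and conclusion. -/

lemma measurableSet_shellBounded {Θ : Type*} [MeasurableSpace Θ] {f : Θ → ℝ → ℝ}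
    (hf : Measurable (Function.uncurry f)) (s K : ℝ) :
    MeasurableSet {θ | f θ ∈ shellBounded s K} := by
  have h := MeasurableSet.iInter fun m : ℕ => measurableSet_le
    (measurable_densityMeasure_apply hf (measurableSet_dyadicShell m))
    (measurable_const (a := ENNReal.ofReal (K * 2 ^ (-(s * m)))))
  convert h using 1
  ext θ
  simp [shellBounded]

/-- The posterior of a Dirichlet process mixture of normals gives most of its mass to densities
with small shells, with an explicit bound for a given sample size. -/
lemma IsDirichletProcess.measure_le_abs_posteriorProb_shellBounded_sub_one_le
    {α : ℝ} (hα : 1 < α) {μH : ℝ} {vH : ℝ≥0} {D : Measure (ProbabilityMeasure ℝ)}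
    (h : IsDirichletProcess α (gaussianReal μH vH) D) {p : ℝ} (hp : 1 ≤ p) {K A K₁ a t : ℝ}
    (hK₁ : K₁ = max K 1) (ha : a = max A 1 ^ 4) (ht : t = 8 * a + 2 * p + 2)
    {p₀ : ℝ → ℝ} (hp₀ : Measurable p₀) [IsProbabilityMeasure (densityMeasure p₀)]
    (hpK : p₀ ∈ shellBounded p K) {n : ℕ} (hn : 3 ≤ n) {ε : ℝ} (hε1 : √(Real.log n / n) ≤ ε)
    (hε2 : ε ≤ A * (n : ℝ) ^ (-(p / (2 + 2 * p)))) {σ : ℝ≥0} (hσ : 0 < σ) (hσ1 : σ ≤ 1)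
    (hprior : Real.exp (-(n * ε ^ 2)) ≤ priorProb D (normalMixture σ) (klNeighborhood p₀ ε))
    {Ω : Type*} [MeasurableSpace Ω] {P : Measure Ω} [IsProbabilityMeasure P] {X : ℕ → Ω → ℝ}
    (hX : ∀ i, Measurable (X i)) (hi : iIndepFun X P)
    (hν : ∀ i, P.map (X i) = densityMeasure p₀) {δ : ℝ} (hδ : 0 < δ) :
    P {ω | δ ≤ |posteriorProb D (normalMixture σ) p₀ (fun i : Fin n => X i ω)
        (shellBounded p (4 * K₁ + 14)) - 1|} ≤
      ENNReal.ofReal (2 * (1 / Real.log n) + 1 / n + 2 * (1 + 2 * (2 * α / (α - 1) *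
        (2 * Real.exp (|μH| * t + (vH + 1) * t ^ 2 / 2 + t)))) / δ * (1 / n)) := by
  have hD := h.isProbabilityMeasure
  have hα1 : 0 < α - 1 := by linarith
  set C := 2 * α / (α - 1) * (2 * Real.exp (|μH| * t + (vH + 1) * t ^ 2 / 2 + t)) with hC
  have hC0 : 0 ≤ C := by positivity
  have hn0 : (0 : ℝ) < n := by positivity
  have hn1 : (1 : ℝ) < n := by exact_mod_cast (by omega : 1 < n)
  have hlog : 0 < Real.log n := Real.log_pos hn1
  have hε0 : 0 < ε := (Real.sqrt_pos.2 (by positivity)).trans_le hε1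
  have hεsq : Real.log n / n ≤ ε ^ 2 := (Real.sqrt_le_left hε0.le).1 hε1
  set u : ℝ := n * ε ^ 2 with hu
  have hlogu : Real.log n ≤ u := by
    rw [div_le_iff₀ hn0] at hεsq
    linarith
  -- The lower bound on `ε` is used here: a union over at most `n` near shells costs only a factor
  -- `e^u`, and `e^(-u) ≤ 1 / n`.
  have hnu : (n : ℝ) ≤ Real.exp u := (Real.log_le_iff_le_exp hn0).1 hlogu
  have hu0 : 0 < u := hlog.trans_le hlogu
  have hK1 : 1 ≤ K₁ := hK₁ ▸ le_max_right _ _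
  set f := normalMixture σ with hf'
  have hf : Measurable (Function.uncurry f) := measurable_normalMixture σ
  have hfd : ∀ θ, IsProbabilityMeasure (densityMeasure (f θ)) :=
    isProbabilityMeasure_densityMeasure_normalMixture hσ
  set x : ℕ → ℝ := fun m => 2 ^ (-(p * m)) with hx
  have hx0 : ∀ m, 0 < x m := fun m => by positivity
  set K' := 4 * K₁ + 14 with hK'
  set U : ℕ → Set (ProbabilityMeasure ℝ) := fun m =>
    {G | ENNReal.ofReal (K' * x m) < densityMeasure (f G) (dyadicShell m)} with hU
  set S : Finset ℕ := {m ∈ Finset.range n | ε ^ 2 ≤ x m} with hS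
  have hScard : (S.card : ℝ) ≤ n := by
    have h1 : S.card ≤ n := (Finset.card_filter_le _ _).trans (Finset.card_range n).le
    exact_mod_cast h1
  have hSx : ∀ m ∈ S, u ≤ n * x m := fun m hm =>
    mul_le_mul_of_nonneg_left (Finset.mem_filter.1 hm).2 hn0.le
  -- The count under `p₀` exceeds `c m` with probability at most `e^(-2 n x_m)`, since `2 n P₀(B_m)
  -- ≤ 2 K₁ n x_m`. Under `U m` the exponent is `c m - n K' x_m / 2 = -5 n x_m`, which explains `K'
  -- = 4 K₁ + 14`. On near shells `n x_m ≥ u`.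
  set c : ℕ → ℝ := fun m => (2 * K₁ + 2) * (n * x m) with hc
  have hUm : ∀ m, MeasurableSet (U m) := fun m => measurableSet_lt measurable_const
    (measurable_densityMeasure_apply hf (measurableSet_dyadicShell m))
  have hAU : {θ | f θ ∈ shellBounded p K'}ᶜ ⊆ ⋃ m, U m := by
    intro θ hθ
    by_contra hcon
    refine hθ fun m => not_lt.1 fun hlt => hcon (Set.mem_iUnion.2 ⟨m, hlt⟩)
  have hρS : ∀ m ∈ S, ∀ θ ∈ U m, ENNReal.ofReal (Real.exp
      (c m - n * ((densityMeasure (f θ)).real (dyadicShell m) / 2))) ≤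
        ENNReal.ofReal (Real.exp (-(5 * u))) := by
    intro m hm θ hθ
    have := hfd θ
    have h1 : K' * x m ≤ (densityMeasure (f θ)).real (dyadicShell m) :=
      (ENNReal.ofReal_le_iff_le_toReal (measure_ne_top _ _)).1 (le_of_lt hθ)
    have h2 := mul_le_mul_of_nonneg_left h1 hn0.le
    have h3 := hSx m hm
    refine ENNReal.ofReal_le_ofReal (Real.exp_le_exp.2 ?_)
    rw [hc]
    rw [hK'] at h2
    linarith
  set τ : ℕ → ℝ≥0∞ := fun m => ENNReal.ofReal (C * Real.exp (-(4 * u)) * (1 / 2) ^ m) with hτ'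
  have hτ : ∀ m ∉ S, D (U m) ≤ τ m := by
    intro m hm
    -- The restriction to `Finset.range n` in `S` excludes no near shell.
    have hlt : x m < ε ^ 2 := by
      by_contra! hge
      exact hm (Finset.mem_filter.2 ⟨Finset.mem_range.2 (lt_of_sq_le_two_rpow hp hn hεsq hge), hge⟩)
    refine h.measure_lt_densityMeasure_dyadicShell_le hα hσ hσ1 (by linarith) (by linarith)
      (by rw [ha]; positivity) ?_ ht
    rw [ha]
    exact mul_sq_le_of_two_rpow_lt hp hε0 (by omega) hε2 hlt
  have hτsum : ∑' m, τ m = ENNReal.ofReal (C * Real.exp (-(4 * u)) * 2) := by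
    rw [hτ', ← ENNReal.ofReal_tsum_of_nonneg (fun m => by positivity)
      (summable_geometric_two.mul_left _), tsum_mul_left, tsum_geometric_two]
  have hκ : ENNReal.ofReal (Real.exp (-u)) ≤ D {θ | f θ ∈ klNeighborhood p₀ ε} := by
    rw [← ofReal_measureReal]
    exact ENNReal.ofReal_le_ofReal hprior
  have hκ0 : D {θ | f θ ∈ klNeighborhood p₀ ε} ≠ 0 := by
    intro h0
    rw [h0] at hκ
    rw [nonpos_iff_eq_zero, ENNReal.ofReal_eq_zero] at hκ
    exact absurd hκ (not_le.2 (Real.exp_pos _))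
  -- The factor `e^(-2u)` is the likelihood bound and `e^(-u) / 2` is half the prior mass of the
  -- neighbourhood.
  set η : ℝ≥0∞ := ENNReal.ofReal (Real.exp (-(3 * u)) / 2) with hη
  have hη0 : η ≠ 0 := by
    rw [hη]
    simp [Real.exp_pos]
  have hηle : η ≤ ENNReal.ofReal (Real.exp (-(2 * u))) *
      (D {θ | f θ ∈ klNeighborhood p₀ ε} / 2) := by
    calc η = ENNReal.ofReal (Real.exp (-(2 * u))) * (ENNReal.ofReal (Real.exp (-u)) / 2) := by
          rw [hη, ← mul_div_assoc, ← ENNReal.ofReal_mul (Real.exp_pos _).le, ← Real.exp_add,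
            ENNReal.ofReal_div_of_pos two_pos, ENNReal.ofReal_ofNat]
          ring_nf
      _ ≤ _ := by gcongr
  have hmain := measure_le_abs_posteriorProb_sub_one_le (D := D) hf hp₀ hfd hX hi hν
    (measurableSet_shellBounded hf p K') hAU hUm measurableSet_dyadicShell S c hη0 hδ hρS
    ENNReal.ofReal_ne_top hτ
  refine hmain.trans ?_
  have hlog' : 1 / u ≤ 1 / Real.log n := one_div_le_one_div_of_le hlog hlogu
  have hexp_neg : Real.exp (-u) ≤ 1 / n := by
    rw [Real.exp_neg, ← one_div]
    exact one_div_le_one_div_of_le hn0 hnu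
  have hb1 : P {ω | integratedLikelihood D f p₀ (fun i : Fin n => X i ω) Set.univ < η} ≤
      ENNReal.ofReal (2 * (1 / Real.log n)) := by
    calc _ ≤ P {ω | integratedLikelihood D f p₀ (fun i : Fin n => X i ω) Set.univ <
          ENNReal.ofReal (Real.exp (-(2 * u))) * (D {θ | f θ ∈ klNeighborhood p₀ ε} / 2)} :=
          measure_mono fun ω hω => lt_of_lt_of_le hω hηle
      _ ≤ 2 * ENNReal.ofReal (1 / u) := measure_integratedLikelihood_univ_lt_le hf
          (normalMixture_pos hσ) hp₀ hX hi hν hε0 (by omega) hκ0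
      _ ≤ 2 * ENNReal.ofReal (1 / Real.log n) := by gcongr
      _ = _ := by rw [ENNReal.ofReal_mul zero_le_two, ENNReal.ofReal_ofNat]
  have hb2 : ∑ m ∈ S, P {ω | c m < sampleCount X (dyadicShell m) n ω} ≤
      ENNReal.ofReal (1 / n) := by
    calc _ ≤ ∑ _m ∈ S, ENNReal.ofReal (Real.exp (-(2 * u))) := by
          refine Finset.sum_le_sum fun m hm => ?_
          refine (measure_lt_sampleCount_le hX hi hν (measurableSet_dyadicShell m) n _).trans ?_
          refine ENNReal.ofReal_le_ofReal (Real.exp_le_exp.2 ?_)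
          have h1 : (densityMeasure p₀).real (dyadicShell m) ≤ K₁ * x m := by
            refine ENNReal.toReal_le_of_le_ofReal (by positivity) ((hpK m).trans ?_)
            refine ENNReal.ofReal_le_ofReal (mul_le_mul_of_nonneg_right ?_ (hx0 m).le)
            exact hK₁ ▸ le_max_left _ _
          have h2 := mul_le_mul_of_nonneg_left h1 hn0.le
          have h3 := hSx m hm
          rw [hc]
          linarith
      _ = ENNReal.ofReal (S.card * Real.exp (-(2 * u))) := by
          rw [Finset.sum_const, nsmul_eq_mul, ENNReal.ofReal_mul (by positivity),
            ENNReal.ofReal_natCast]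
      _ ≤ _ := by
          refine ENNReal.ofReal_le_ofReal (le_trans ?_ hexp_neg)
          calc S.card * Real.exp (-(2 * u)) ≤ Real.exp u * Real.exp (-(2 * u)) := by
                gcongr
                exact hScard.trans hnu
            _ = Real.exp (-u) := by rw [← Real.exp_add]; ring_nf
  have hb3 : (S.card * ENNReal.ofReal (Real.exp (-(5 * u))) + ∑' m, τ m) /
      (ENNReal.ofReal δ * η) ≤ ENNReal.ofReal (2 * (1 + 2 * C) / δ * (1 / n)) := by
    have hden : 0 < δ * (Real.exp (-(3 * u)) / 2) := by positivity
    rw [hτsum, hη, ← ENNReal.ofReal_mul hδ.le, ← ENNReal.ofReal_natCast,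
      ← ENNReal.ofReal_mul (by positivity), ← ENNReal.ofReal_add (by positivity) (by positivity),
      ← ENNReal.ofReal_div_of_pos hden]
    refine ENNReal.ofReal_le_ofReal ?_
    rw [div_le_iff₀ hden]
    -- Both contributions are of order `e^(-4u)`, since `e^u e^(-5u) = e^(-4u)`; dividing by `η`
    -- leaves `e^(-u) ≤ 1 / n`.
    have e1 : Real.exp (-(4 * u)) = Real.exp (-u) * Real.exp (-(3 * u)) := by
      rw [← Real.exp_add]; ring_nf
    calc S.card * Real.exp (-(5 * u)) + C * Real.exp (-(4 * u)) * 2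
        ≤ Real.exp u * Real.exp (-(5 * u)) + C * Real.exp (-(4 * u)) * 2 := by
          gcongr
          exact hScard.trans hnu
      _ = (1 + 2 * C) * (Real.exp (-u) * Real.exp (-(3 * u))) := by
          rw [← Real.exp_add, ← e1, show u + -(5 * u) = -(4 * u) by ring]
          ring
      _ ≤ (1 + 2 * C) * (1 / n * Real.exp (-(3 * u))) := by gcongr
      _ = _ := by field_simp
  rw [ENNReal.ofReal_add (by positivity) (by positivity),
    ENNReal.ofReal_add (by positivity) (by positivity)]
  exact add_le_add (add_le_add hb1 hb2) hb3

theorem mainTheorem6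
    (α : ℝ) (hα : 1 < α) (μH : ℝ) (vH : ℝ≥0) (hvH : 0 < vH)
    (p : ℝ) (hp : 1 ≤ p) (K A : ℝ) :
    ∃ K' : ℝ, ∀ (D : Measure (ProbabilityMeasure ℝ)),
      IsDirichletProcess α (gaussianReal μH vH) D →
      ∀ (p₀ : ℝ → ℝ), Measurable p₀ → (∀ x, 0 ≤ p₀ x) →
      IsProbabilityMeasure (densityMeasure p₀) →
      p₀ ∈ shellBounded p K →
      ∀ (ε : ℕ → ℝ), Tendsto ε atTop (𝓝 0) →
      (∀ n : ℕ, 1 ≤ n → √(Real.log n / n) ≤ ε n) →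
      (∀ n : ℕ, 1 ≤ n → ε n ≤ A * (n : ℝ) ^ (-(p / (2 + 2 * p)))) →
      ∀ (σ : ℕ → ℝ≥0), (∀ n, 0 < σ n) → Tendsto σ atTop (𝓝 0) →
      (∀ᶠ n : ℕ in atTop,
        Real.exp (-(n * ε n ^ 2)) ≤
          priorProb D (normalMixture (σ n)) (klNeighborhood p₀ (ε n))) →
      ∀ {Ω : Type*} [MeasurableSpace Ω] (P : Measure Ω) [IsProbabilityMeasure P]
        (X : ℕ → Ω → ℝ), (∀ i, Measurable (X i)) → iIndepFun X P →
      (∀ i, P.map (X i) = densityMeasure p₀) →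
      TendstoInMeasure P
        (fun (n : ℕ) (ω : Ω) =>
          posteriorProb D (normalMixture (σ n)) p₀ (fun i : Fin n => X i ω) (shellBounded p K'))
        atTop (fun _ => 1) := by
  refine ⟨4 * max K 1 + 14, fun D hD p₀ hp₀ _ hprob hpK ε _ hε1 hε2 σ hσ hσ0 hprior Ω _ P _ X hX
    hi hν => ?_⟩
  rw [tendstoInMeasure_iff_dist]
  intro δ hδ
  simp only [Real.dist_eq]
  obtain ⟨c, hc⟩ : ∃ c : ℝ, c = 2 * (1 + 2 * (2 * α / (α - 1) * (2 * Real.exp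
      (|μH| * (8 * max A 1 ^ 4 + 2 * p + 2) + (vH + 1) * (8 * max A 1 ^ 4 + 2 * p + 2) ^ 2 / 2 +
        (8 * max A 1 ^ 4 + 2 * p + 2))))) / δ := ⟨_, rfl⟩
  have hlim : Tendsto (fun n : ℕ => ENNReal.ofReal
      (2 * (1 / Real.log n) + 1 / n + c * (1 / n))) atTop (𝓝 0) := by
    have h1 : Tendsto (fun n : ℕ => 1 / Real.log n) atTop (𝓝 0) := by
      simp only [one_div]
      exact (Real.tendsto_log_atTop.comp tendsto_natCast_atTop_atTop).inv_tendsto_atTop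
    have h2 : Tendsto (fun n : ℕ => 1 / (n : ℝ)) atTop (𝓝 0) := tendsto_one_div_atTop_nhds_zero_nat
    simpa using ENNReal.tendsto_ofReal (((h1.const_mul 2).add h2).add (h2.const_mul c))
  refine tendsto_of_tendsto_of_tendsto_of_le_of_le' tendsto_const_nhds hlim
    (Eventually.of_forall fun _ => zero_le) ?_
  -- Eventually `σ ≤ 1`, so the variance `vH + σ²` is at most `vH + 1` and the constants do not
  -- depend on `n`.
  filter_upwards [hprior, eventually_ge_atTop 3, hσ0.eventually_le_const one_pos] with n hpn hn hσn
  rw [hc]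
  exact hD.measure_le_abs_posteriorProb_shellBounded_sub_one_le hα hp rfl rfl rfl hp₀ hpK hn
    (hε1 n (by omega)) (hε2 n (by omega)) (hσ n) hσn hpn hX hi hν hδ
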